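/- **Setting.** Let $\mathbb H$ be the quaternions, $|q|$ the Euclidean norm and $\mathrm{Re}\,q$ the real part of $q\in\mathbb H$. Let $a_{11},a_{12},a_{21},a_{22}:[t_0,+\infty)\to\mathbb H$ be continuous. Consider the linear system $$\phi'=a_{11}(t)\phi+a_{12}(t)\psi,\qquad \psi'=a_{21}(t)\phi+a_{22}(t)\psi,\qquad t\ge t_0, \tag{4.1}$$ and its Riccati equation $$q'+q\,a\,q+b\,q+q\,c+d=0,\qquad a=a_{12},\; b=-a_{22},\; c=a_{11},\; d=-a_{21}. \tag{4.2}$$ *Definitions for the equation.* For $t_1\ge t_0$, a solution of (4.2) is *$t_1$-regular* if it is defined on all of $[t_1,+\infty)$. A $t_1$-regular solution $q$ is *$t_1$-normal* if, for some neighbourhood $U$ of $q(t_1)$, every solution $\tilde q$ with $\tilde q(t_1)\in U$ is $t_1$-regular; otherwise it is *$t_1$-extremal*. Equation (4.2) is *regular* if it has a $t_1$-regular solution for some $t_1\ge t_0$. It is *normal* if it is regular and has no $t_1$-extremal solution for any $t_1\ge t_0$. It is *extremal* if, for some $t_1\ge t_0$, it has a $t_1$-regular solution $q$ such that for all $t\ge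 t_1$ the integral $\nu_q(t)=\int_t^{+\infty}\phi_q^{-1}a\,\psi_q^{-1}\,d\tau$ converges (as a limit of integrals over bounded intervals) and is nonzero; here $\phi_q'=(aq+c)\phi_q$ and $\psi_q'=\psi_q(b+qa)$ on $[t_1,+\infty)$, with $\phi_q(t_1)=\psi_q(t_1)=1$. *Definitions for the system.* A solution $(\phi,\psi)$ of (4.1) on $[t_0,+\infty)$ is *$T$-regular* ($T\ge t_0$) if $\phi(t)\ne0$ for all $t\ge T$. A $T$-regular solution is *principal* if $\psi\phi^{-1}$ is a $T$-extremal solution of (4.2), and *non-principal* if $\psi\phi^{-1}$ is a $T$-normal solution of (4.2). A principal (non-principal) solution without mention of $T$ is one that is so for some $T\ge t_0$. The system is *regular* if it has a $T$-regular solution for some $T\ge t_0$; a regular system is *normal* (*extremal*) if (4.2) is. *Components.* For $x\in\{a,b,c,d\}$ write $x=x_0+ix_1+jx_2+kx_3$, and put $$\begin{aligned} (p_{01},p_{02},p_{03})&=(b_1+c_1,\;b_2+c_2,\;b_3+c_3),&(p_{11},p_{12},p_{13})&=(b_1+c_1,\;b_2-c_2,\;b_3-c_3),\\ (p_{21},p_{22},p_{23})&=(b_1-c_1,\;b_2+c_2,\;b_3-c_3),&(p_{31},p_{32},p_{33})&=(b_1-c_1,\;b_2-c_2,\;b_3+c_3).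 \end{aligned}$$ With $\varepsilon_0=1$ and $\varepsilon_1=\varepsilon_2=\varepsilon_3=-1$, put $$D_n(t)=\sum_{m=1}^3p_{nm}^2(t)+4\varepsilon_n a_n(t)d_n(t)\ \text{ if } a_n(t)\ne0,\qquad D_n(t)=4\varepsilon_n d_n(t)\ \text{ if } a_n(t)=0.$$ **Theorem 4.2.** Let $\mathfrak S$ be a non-empty subset of $\{0,1,2,3\}$ and assume the following. $\alpha$) For all $t\ge t_0$: if $n\in\mathfrak S$, then $a_n(t)\ge0$, and whenever $a_n(t)=0$ also $p_{nm}(t)=0$ for $m=1,2,3$; if $n\notin\mathfrak S$, then $a_n(t)=0$; and $D_n(t)\le0$ for $n=0,1,2,3$. $\beta$) $\displaystyle\int_{t_0}^{+\infty}|a_{12}(\tau)|\exp\Bigl\{\int_{t_0}^{\tau}[\mathrm{Re}\,a_{22}(s)-\mathrm{Re}\,a_{11}(s)]\,ds\Bigr\}d\tau<+\infty.$ Then: 1) The system (4.1) is either normal or extremal, and not both. 2) For every $T\ge t_0$ and every $T$-regular non-principal solution $(\phi,\psi)$ of (4.1) the integral $$\int_T^{+\infty}\frac{|a_{12}(\tau)|}{|\phi(\tau)|^2}\exp\Bigl\{\int_T^\tau[\mathrm{Re}\,a_{11}(s)+\mathrm{Re}\,a_{22}(s)]\,ds\Bigr\}d\tau$$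 converges. 3) If (4.1) is extremal, then there is a principal solution $(\phi_*,\psi_*)$, and it is unique up to a right multiplier: the principal solutions are exactly the pairs $(\phi_*\lambda,\psi_*\lambda)$ with $\lambda\in\mathbb H\setminus\{0\}$. Moreover: $3_1$) for every $T_*\ge t_0$ such that $\phi_*(t)\neq0$ for all $t\ge T_*$, $$\int_{T_*}^{+\infty}\frac{|a_{12}(\tau)|}{|\phi_*(\tau)|^2}\exp\Bigl\{\int_{T_*}^\tau[\mathrm{Re}\,a_{11}(s)+\mathrm{Re}\,a_{22}(s)]\,ds\Bigr\}d\tau=+\infty;$$ $3_2$) $\displaystyle\lim_{t\to+\infty}\frac{|\phi_*(t)|}{|\phi(t)|}=0$ for every non-principal solution $(\phi,\psi)$; $3_3$) for any two non-principal solutions $(\phi_1,\psi_1)$, $(\phi_2,\psi_2)$ the limit $\displaystyle\lim_{t\to+\infty}\frac{|\phi_1(t)|}{|\phi_2(t)|}$ exists, is finite and is nonzero. -/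

import Mathlib

open Set Filter Topology MeasureTheory

noncomputable section

namespace QuatRiccati

/-- The improper integral of `f` over `[s, +∞)` converges, in the sense of the limit of the
integrals over `[s, t]` as `t → +∞`, and its value is `L`. -/
def HasImproperIntegral (f : ℝ → Quaternion ℝ) (s : ℝ) (L : Quaternion ℝ) : Prop :=
  Tendsto (fun t => ∫ τ in s..t, f τ) atTop (𝓝 L)

/-! ### The Riccati equation `q' + q a q + b q + q c + d = 0` on `[t₀, +∞)` -/

/-- `q` is a `t₁`-regular solution: it solves the Riccati equation on all of `[t₁, +∞)`
(with the one-sided derivative at `t₁`). -/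
def IsRegularSol (a b c d : ℝ → Quaternion ℝ) (t₁ : ℝ) (q : ℝ → Quaternion ℝ) : Prop :=
  ∀ t ∈ Ici t₁, HasDerivWithinAt q
    (-(q t * a t * q t + b t * q t + q t * c t + d t)) (Ici t₁) t

/-- `q` is a `t₁`-normal solution: it is `t₁`-regular, and the solution starting at `t₁` from
any value in some neighbourhood of `q t₁` is `t₁`-regular as well. -/
def IsNormalSol (a b c d : ℝ → Quaternion ℝ) (t₁ : ℝ) (q : ℝ → Quaternion ℝ) : Prop :=
  IsRegularSol a b c d t₁ q ∧
    ∃ U ∈ 𝓝 (q t₁), ∀ γ ∈ U, ∃ r : ℝ → Quaternion ℝ, IsRegularSol a b c d t₁ r ∧ r t₁ = γ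

/-- `q` is a `t₁`-extremal solution: it is `t₁`-regular but not `t₁`-normal. -/
def IsExtremalSol (a b c d : ℝ → Quaternion ℝ) (t₁ : ℝ) (q : ℝ → Quaternion ℝ) : Prop :=
  IsRegularSol a b c d t₁ q ∧ ¬ IsNormalSol a b c d t₁ q

/-- The Riccati equation is regular: it has a `t₁`-regular solution for some `t₁ ≥ t₀`. -/
def EqRegular (t₀ : ℝ) (a b c d : ℝ → Quaternion ℝ) : Prop :=
  ∃ t₁ ≥ t₀, ∃ q, IsRegularSol a b c d t₁ q

/-- The Riccati equation is normal: it is regular and has no extremal solution. -/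
def EqNormal (t₀ : ℝ) (a b c d : ℝ → Quaternion ℝ) : Prop :=
  EqRegular t₀ a b c d ∧ ¬ ∃ t₁ ≥ t₀, ∃ q, IsExtremalSol a b c d t₁ q

/-- `φ` is the solution of `φ' = (a q + c) φ` on `[t₁, +∞)` with `φ t₁ = 1`. -/
def IsPhi (a c q : ℝ → Quaternion ℝ) (t₁ : ℝ) (φ : ℝ → Quaternion ℝ) : Prop :=
  φ t₁ = 1 ∧ ∀ t ∈ Ici t₁, HasDerivWithinAt φ ((a t * q t + c t) * φ t) (Ici t₁) t

/-- `ψ` is the solution of `ψ' = ψ (b + q a)` on `[t₁, +∞)` with `ψ t₁ = 1`. -/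
def IsPsi (a b q : ℝ → Quaternion ℝ) (t₁ : ℝ) (ψ : ℝ → Quaternion ℝ) : Prop :=
  ψ t₁ = 1 ∧ ∀ t ∈ Ici t₁, HasDerivWithinAt ψ (ψ t * (b t + q t * a t)) (Ici t₁) t

/-- The Riccati equation is extremal: for some `t₁ ≥ t₀` there is a `t₁`-regular solution `q`
such that the integrals `ν_q(t) = ∫_t^∞ φ⁻¹ a ψ⁻¹` (with `φ`, `ψ` attached to `q` as above)
converge and are nonzero for all `t ≥ t₁`. -/
def EqExtremal (t₀ : ℝ) (a b c d : ℝ → Quaternion ℝ) : Prop :=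
  ∃ t₁ ≥ t₀, ∃ q φ ψ : ℝ → Quaternion ℝ,
    IsRegularSol a b c d t₁ q ∧ IsPhi a c q t₁ φ ∧ IsPsi a b q t₁ ψ ∧
      ∀ t ≥ t₁, ∃ L : Quaternion ℝ,
        HasImproperIntegral (fun τ => (φ τ)⁻¹ * a τ * (ψ τ)⁻¹) t L ∧ L ≠ 0

/-! ### The linear system `φ' = a₁₁ φ + a₁₂ ψ`, `ψ' = a₂₁ φ + a₂₂ ψ` on `[t₀, +∞)`

Its Riccati equation is `q' + q a₁₂ q - a₂₂ q + q a₁₁ - a₂₁ = 0`. -/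

/-- `(φ, ψ)` is a solution of the linear system on `[t₀, +∞)`. -/
def IsSysSol (t₀ : ℝ) (a11 a12 a21 a22 φ ψ : ℝ → Quaternion ℝ) : Prop :=
  ∀ t ∈ Ici t₀, HasDerivWithinAt φ (a11 t * φ t + a12 t * ψ t) (Ici t₀) t ∧
    HasDerivWithinAt ψ (a21 t * φ t + a22 t * ψ t) (Ici t₀) t

/-- `(φ, ψ)` is a `T`-regular solution of the linear system. -/
def IsSysRegularSol (t₀ : ℝ) (a11 a12 a21 a22 : ℝ → Quaternion ℝ) (T : ℝ)
    (φ ψ : ℝ → Quaternion ℝ) : Prop :=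
  IsSysSol t₀ a11 a12 a21 a22 φ ψ ∧ ∀ t ≥ T, φ t ≠ 0

/-- `(φ, ψ)` is a `T`-regular principal solution: `ψ φ⁻¹` is a `T`-extremal solution of the
Riccati equation of the system. -/
def IsPrincipalAt (t₀ : ℝ) (a11 a12 a21 a22 : ℝ → Quaternion ℝ) (T : ℝ)
    (φ ψ : ℝ → Quaternion ℝ) : Prop :=
  IsSysRegularSol t₀ a11 a12 a21 a22 T φ ψ ∧
    IsExtremalSol a12 (-a22) a11 (-a21) T (fun t => ψ t * (φ t)⁻¹)

/-- `(φ, ψ)` is a `T`-regular non-principal solution: `ψ φ⁻¹` is a `T`-normal solution of the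
Riccati equation of the system. -/
def IsNonPrincipalAt (t₀ : ℝ) (a11 a12 a21 a22 : ℝ → Quaternion ℝ) (T : ℝ)
    (φ ψ : ℝ → Quaternion ℝ) : Prop :=
  IsSysRegularSol t₀ a11 a12 a21 a22 T φ ψ ∧
    IsNormalSol a12 (-a22) a11 (-a21) T (fun t => ψ t * (φ t)⁻¹)

/-- `(φ, ψ)` is a principal solution. -/
def IsPrincipal (t₀ : ℝ) (a11 a12 a21 a22 φ ψ : ℝ → Quaternion ℝ) : Prop :=
  ∃ T ≥ t₀, IsPrincipalAt t₀ a11 a12 a21 a22 T φ ψ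

/-- `(φ, ψ)` is a non-principal solution. -/
def IsNonPrincipal (t₀ : ℝ) (a11 a12 a21 a22 φ ψ : ℝ → Quaternion ℝ) : Prop :=
  ∃ T ≥ t₀, IsNonPrincipalAt t₀ a11 a12 a21 a22 T φ ψ

/-- `(φ₂, ψ₂)` is obtained from `(φ₁, ψ₁)` on `[t₀, +∞)` by a nonzero constant right
multiplier. -/
def RightDependent (t₀ : ℝ) (φ₁ ψ₁ φ₂ ψ₂ : ℝ → Quaternion ℝ) : Prop :=
  ∃ l : Quaternion ℝ, l ≠ 0 ∧ ∀ t ≥ t₀, φ₂ t = φ₁ t * l ∧ ψ₂ t = ψ₁ t * l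

/-- The system is regular: it has a `t₁`-regular solution for some `t₁ ≥ t₀`. -/
def SysRegular (t₀ : ℝ) (a11 a12 a21 a22 : ℝ → Quaternion ℝ) : Prop :=
  ∃ t₁ ≥ t₀, ∃ φ ψ, IsSysRegularSol t₀ a11 a12 a21 a22 t₁ φ ψ

/-- The system is normal: it is regular and its Riccati equation is normal. -/
def SysNormal (t₀ : ℝ) (a11 a12 a21 a22 : ℝ → Quaternion ℝ) : Prop :=
  SysRegular t₀ a11 a12 a21 a22 ∧ EqNormal t₀ a12 (-a22) a11 (-a21)

/-- The system is extremal: it is regular and its Riccati equation is extremal. -/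
def SysExtremal (t₀ : ℝ) (a11 a12 a21 a22 : ℝ → Quaternion ℝ) : Prop :=
  SysRegular t₀ a11 a12 a21 a22 ∧ EqExtremal t₀ a12 (-a22) a11 (-a21)

/-! ### The sign conditions -/

/-- The four real components `x₀, x₁, x₂, x₃` of `x = x₀ + i x₁ + j x₂ + k x₃`. -/
def comp (x : Quaternion ℝ) : Fin 4 → ℝ := ![x.re, x.imI, x.imJ, x.imK]

/-- The numbers `p_{nm}`, `n = 0, 1, 2, 3`, `m = 1, 2, 3` (the index `m = 1, 2, 3` is
represented by `0, 1, 2 : Fin 3`). -/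
def pCoef (b c : Quaternion ℝ) : Fin 4 → Fin 3 → ℝ :=
  ![![b.imI + c.imI, b.imJ + c.imJ, b.imK + c.imK],
    ![b.imI + c.imI, b.imJ - c.imJ, b.imK - c.imK],
    ![b.imI - c.imI, b.imJ + c.imJ, b.imK - c.imK],
    ![b.imI - c.imI, b.imJ - c.imJ, b.imK + c.imK]]

open Classical in
/-- The discriminants `D_0, D_1, D_2, D_3`. The sign is `+1` for `n = 0` and `-1` for
`n = 1, 2, 3`. -/
def disc (a b c d : Quaternion ℝ) (n : Fin 4) : ℝ :=
  let sgn : ℝ := if n = 0 then 1 else -1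
  if comp a n ≠ 0 then (∑ m, pCoef b c n m ^ 2) + sgn * (4 * comp a n * comp d n)
  else sgn * (4 * comp d n)

end QuatRiccati

end

/-! Everything is read off one explicit solution. Start the linear system at `(1, 0)`. The sign
conditions keep the relevant coordinates of `ψ * star φ` nonnegative (`coneCoord_deriv_ge`), so `Re
(a12 ψ φ̄) ≥ 0` and `|φ|` is at least `exp ∫ Re a11`. Hence `φ` never vanishes and `q = ψ φ⁻¹` is a
global Riccati solution. With `χ' = χ (b + q a)`, the function `φ⁻¹ a12 χ⁻¹` is dominated by the
integrand of the integrability hypothesis, so its primitive `μ` has a limit `ν`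
(`exists_isReference`).

Reduction of order gives every solution of the system as `f = φ (α + μ β)`, `g = q f + χ⁻¹ β`
(`IsReference.hasCoefficients`). When `f` is zero-free from `T` on, `g f⁻¹` is normal exactly when
`α + ν β ≠ 0` (`isNormalSol_iff_of_hasCoefficients`). A principal solution therefore has `f = φ (μ -
ν) β` with `β ≠ 0`, and one exists iff `μ` eventually avoids `ν`. That condition is extremality of
the equation (`eqExtremal_iff`) and its negation is normality (`eqNormal_iff`), which gives the
dichotomy.

Quotients of norms tend to quotients of the `‖α + ν β‖`. For a non-principal solution, `‖f‖` is
bounded below by a multiple of `‖φ‖`, so the weighted integral converges. For a principal one the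
integrand is a constant times `‖((μ - ν)⁻¹)'‖`, and `(μ - ν)⁻¹` is unbounded. -/

noncomputable section

namespace QuatRiccati


/-! ### One-sided calculus on a half-line. -/

section Calculus

variable {E : Type*} [NormedAddCommGroup E] [NormedSpace ℝ E]

/-- Freezing `f` to the left of `T` yields a function continuous on all of `ℝ`, to which two-sided
results apply. -/
lemma continuous_comp_max {X : Type*} [TopologicalSpace X] {T : ℝ} {f : ℝ → X}
    (hf : ContinuousOn f (Ici T)) : Continuous fun t => f (max T t) :=
  hf.comp_continuous (by fun_prop) fun t => le_max_left T t

lemma hasDerivWithinAt_integral_Ici [CompleteSpace E] {T : ℝ} {f : ℝ → E}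
    (hf : ContinuousOn f (Ici T)) {t : ℝ} (ht : T ≤ t) :
    HasDerivWithinAt (fun s => ∫ τ in T..s, f τ) (f t) (Ici T) t := by
  have hc := continuous_comp_max hf
  have h := (intervalIntegral.integral_hasDerivAt_right (hc.intervalIntegrable T t)
    hc.stronglyMeasurable.stronglyMeasurableAtFilter hc.continuousAt).hasDerivWithinAt
      (s := Ici T)
  have he : ∀ s ∈ Ici T, (∫ τ in T..s, f τ) = ∫ τ in T..s, f (max T τ) := by
    intro s hs
    refine intervalIntegral.integral_congr fun τ hτ => ?_
    rw [uIcc_of_le hs] at hτ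
    simp [max_eq_right hτ.1]
  rw [max_eq_right ht] at h
  exact h.congr he (he t ht)

lemma hasDerivWithinAt_Ici_mono {T s t : ℝ} {f : ℝ → E} {f' : E}
    (h : HasDerivWithinAt f f' (Ici T) t) (hs : T ≤ s) : HasDerivWithinAt f f' (Ici s) t :=
  h.mono (Ici_subset_Ici.2 hs)

lemma continuousOn_of_hasDerivWithinAt {s : Set ℝ} {f f' : ℝ → E}
    (h : ∀ t ∈ s, HasDerivWithinAt f (f' t) s t) : ContinuousOn f s :=
  fun t ht => (h t ht).continuousWithinAt

lemma eq_of_hasDerivWithinAt_zero {T : ℝ} {f : ℝ → E}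
    (h : ∀ t ∈ Ici T, HasDerivWithinAt f 0 (Ici T) t) {t : ℝ} (ht : T ≤ t) : f t = f T := by
  refine constant_of_has_deriv_right_zero (a := T) (b := t)
    ((continuousOn_of_hasDerivWithinAt h).mono Icc_subset_Ici_self) (fun s hs => ?_) t
    (right_mem_Icc.2 ht)
  exact hasDerivWithinAt_Ici_mono (h s hs.1) hs.1

lemma monotoneOn_of_hasDerivWithinAt_nonneg {T : ℝ} {f f' : ℝ → ℝ}
    (h : ∀ t ∈ Ici T, HasDerivWithinAt f (f' t) (Ici T) t) (hf' : ∀ t ∈ Ici T, 0 ≤ f' t) :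
    MonotoneOn f (Ici T) := by
  refine _root_.monotoneOn_of_hasDerivWithinAt_nonneg (f' := f') (convex_Ici T)
    (continuousOn_of_hasDerivWithinAt h) (fun t ht => ?_) fun t ht => ?_
  · exact (h t (interior_subset ht)).mono interior_subset
  · exact hf' t (interior_subset ht)

/-- The integrating factor: if `x' = g x + N` with `N ≥ 0` then `x exp(-∫ g)` is monotone. -/
lemma monotoneOn_mul_exp_neg_integral {T : ℝ} {x x' g : ℝ → ℝ}
    (h : ∀ t ∈ Ici T, HasDerivWithinAt x (x' t) (Ici T) t) (hg : ContinuousOn g (Ici T))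
    (hN : ∀ t ∈ Ici T, g t * x t ≤ x' t) :
    MonotoneOn (fun t => x t * Real.exp (-∫ s in T..t, g s)) (Ici T) := by
  refine monotoneOn_of_hasDerivWithinAt_nonneg
    (fun t ht => (h t ht).mul (hasDerivWithinAt_integral_Ici hg ht).neg.exp) fun t ht => ?_
  have := hN t ht
  have h2 := Real.exp_pos (-∫ s in T..t, g s)
  simp only [Pi.neg_apply]
  nlinarith

/-- The norm of a solution of an equation whose radial growth rate is `m`. -/
lemma norm_eq_exp_integral {F : Type*} [NormedAddCommGroup F] [InnerProductSpace ℝ F] {T : ℝ}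
    {f f' : ℝ → F} {m : ℝ → ℝ} (h : ∀ t ∈ Ici T, HasDerivWithinAt f (f' t) (Ici T) t)
    (hm : ContinuousOn m (Ici T)) (hi : ∀ t ∈ Ici T, inner ℝ (f t) (f' t) = m t * ‖f t‖ ^ 2)
    {t : ℝ} (ht : T ≤ t) : ‖f t‖ = ‖f T‖ * Real.exp (∫ s in T..t, m s) := by
  have key := eq_of_hasDerivWithinAt_zero (T := T)
    (f := fun t => ‖f t‖ ^ 2 * Real.exp (-(2 * ∫ s in T..t, m s))) (fun s hs => by
      refine ((h s hs).norm_sq.mul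
        ((hasDerivWithinAt_integral_Ici hm hs).const_mul 2).neg.exp).congr_deriv ?_
      rw [hi s hs]
      simp only [Pi.neg_apply]
      ring) ht
  simp only [intervalIntegral.integral_same, mul_zero, neg_zero, Real.exp_zero, mul_one] at key
  have h1 : ‖f t‖ ^ 2 = (‖f T‖ * Real.exp (∫ s in T..t, m s)) ^ 2 := by
    rw [mul_pow, ← key, ← Real.exp_nat_mul, mul_assoc, ← Real.exp_add]
    simp
  exact (sq_eq_sq₀ (norm_nonneg _) (by positivity)).1 h1

lemma hasDerivWithinAt_inv_quaternion {s : Set ℝ} {t : ℝ} {f : ℝ → Quaternion ℝ}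
    {f' : Quaternion ℝ} (h : HasDerivWithinAt f f' s t) (hf : f t ≠ 0) :
    HasDerivWithinAt (fun t => (f t)⁻¹) (-((f t)⁻¹ * f' * (f t)⁻¹)) s t := by
  have := (hasFDerivAt_inv' (𝕜 := ℝ) hf).comp_hasDerivWithinAt t h
  exact this.congr_deriv (by simp)

end Calculus

/-! ### Global existence for linear equations. -/

section LinearODE

variable {E : Type*} [NormedAddCommGroup E] [NormedSpace ℝ E] [CompleteSpace E]

/-- Bielecki's weight: with `Λ' = 2 ‖A‖` and the substitution `y = exp Λ • z`, the Picard operator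
contracts by `1 / 2` on bounded continuous functions over the whole half-line, so no gluing of local
solutions is needed. -/
lemma exists_solution_of_continuous (T : ℝ) {A : ℝ → E →L[ℝ] E} (hA : Continuous A) (x₀ : E) :
    ∃ y : ℝ → E, y T = x₀ ∧ ∀ t ∈ Ici T, HasDerivWithinAt y (A t (y t)) (Ici T) t := by
  set Λ : ℝ → ℝ := fun t => ∫ s in T..t, 2 * ‖A s‖ with hΛ
  have hΛd : ∀ t, HasDerivAt Λ (2 * ‖A t‖) t := fun t =>
    intervalIntegral.integral_hasDerivAt_right
      ((continuous_const.mul hA.norm).intervalIntegrable _ _)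
      (continuous_const.mul hA.norm).stronglyMeasurable.stronglyMeasurableAtFilter
      (continuous_const.mul hA.norm).continuousAt
  have hΛc : Continuous Λ := continuous_iff_continuousAt.2 fun t => (hΛd t).continuousAt
  have hΛT : Λ T = 0 := by simp [hΛ]
  have hΛ0 : ∀ t, T ≤ t → 0 ≤ Λ t := fun t ht =>
    intervalIntegral.integral_nonneg ht fun s _ => by positivity
  have hFc : ∀ z : ℝ → E, Continuous z → Continuous fun s => Real.exp (Λ s) • A s (z s) :=
    fun z hz => (Real.continuous_exp.comp hΛc).smul (hA.clm_apply hz)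
  have hId : ∀ z : ℝ → E, Continuous z → ∀ t,
      HasDerivAt (fun t => ∫ s in T..t, Real.exp (Λ s) • A s (z s))
        (Real.exp (Λ t) • A t (z t)) t := fun z hz t =>
    intervalIntegral.integral_hasDerivAt_right ((hFc z hz).intervalIntegrable _ _)
      (hFc z hz).stronglyMeasurable.stronglyMeasurableAtFilter (hFc z hz).continuousAt
  have hIc : ∀ z : ℝ → E, Continuous z →
      Continuous fun t => ∫ s in T..t, Real.exp (Λ s) • A s (z s) := fun z hz =>
    continuous_iff_continuousAt.2 fun t => (hId z hz t).continuousAt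
  -- The integrand is at most `K / 2` times the derivative of `exp Λ`; the weight cancels after
  -- integration.
  have key : ∀ z : ℝ → E, ∀ K, 0 ≤ K → (∀ t, ‖z t‖ ≤ K) → ∀ t, T ≤ t →
      ‖Real.exp (-Λ t) • ∫ s in T..t, Real.exp (Λ s) • A s (z s)‖ ≤ K / 2 := by
    intro z K hK hzK t ht
    have h1 : ‖∫ s in T..t, Real.exp (Λ s) • A s (z s)‖ ≤
        ∫ s in T..t, K / 2 * (Real.exp (Λ s) * (2 * ‖A s‖)) := by
      refine intervalIntegral.norm_integral_le_of_norm_le ht (ae_of_all _ fun s _ => ?_)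
        (Continuous.intervalIntegrable (by fun_prop) _ _)
      rw [norm_smul, Real.norm_of_nonneg (Real.exp_pos _).le]
      calc Real.exp (Λ s) * ‖A s (z s)‖ ≤ Real.exp (Λ s) * (‖A s‖ * K) := by
            gcongr
            exact ((A s).le_opNorm _).trans (by gcongr; exact hzK s)
        _ = _ := by ring
    rw [intervalIntegral.integral_const_mul, intervalIntegral.integral_eq_sub_of_hasDerivAt
      (fun s _ => (hΛd s).exp) (Continuous.intervalIntegrable (by fun_prop) _ _), hΛT,
      Real.exp_zero] at h1
    rw [norm_smul, Real.norm_of_nonneg (Real.exp_pos _).le]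
    calc Real.exp (-Λ t) * _ ≤ Real.exp (-Λ t) * (K / 2 * (Real.exp (Λ t) - 1)) := by gcongr
      _ ≤ Real.exp (-Λ t) * (K / 2 * Real.exp (Λ t)) := by gcongr; linarith
      _ = K / 2 * (Real.exp (-Λ t) * Real.exp (Λ t)) := by ring
      _ = K / 2 := by rw [← Real.exp_add]; simp
  let P : BoundedContinuousFunction ℝ E → BoundedContinuousFunction ℝ E := fun z =>
    BoundedContinuousFunction.ofNormedAddCommGroup
      (fun t => Real.exp (-Λ (max T t)) •
        (x₀ + ∫ s in T..max T t, Real.exp (Λ s) • A s (z s)))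
      (by
        have := (hIc z z.continuous).comp (continuous_const.max continuous_id : Continuous (max T))
        have h2 : Continuous fun t => Real.exp (-Λ (max T t)) := by fun_prop
        exact h2.smul (continuous_const.add this))
      (‖x₀‖ + ‖z‖ / 2) (fun t => by
        rw [smul_add]
        refine (norm_add_le _ _).trans (add_le_add ?_
          (key z ‖z‖ (norm_nonneg _) z.norm_coe_le_norm _ (le_max_left _ _)))
        rw [norm_smul, Real.norm_of_nonneg (Real.exp_pos _).le]
        refine mul_le_of_le_one_left (norm_nonneg _) (Real.exp_le_one_iff.2 ?_)
        linarith [hΛ0 _ (le_max_left T t)])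
  have hP : ContractingWith (1 / 2) P := by
    refine ⟨by norm_num, LipschitzWith.of_dist_le_mul fun z w => ?_⟩
    rw [BoundedContinuousFunction.dist_le (by positivity)]
    intro t
    have h1 := key (fun s => z s - w s) (dist z w) dist_nonneg
      (fun s => by rw [← dist_eq_norm]; exact BoundedContinuousFunction.dist_coe_le_dist s)
      (max T t) (le_max_left _ _)
    have h2 : P z t - P w t = Real.exp (-Λ (max T t)) •
        ∫ s in T..max T t, Real.exp (Λ s) • A s (z s - w s) := by
      have h3 : ∀ s, Real.exp (Λ s) • A s (z s - w s) =
          Real.exp (Λ s) • A s (z s) - Real.exp (Λ s) • A s (w s) := fun s => by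
        rw [map_sub, smul_sub]
      simp only [h3]
      rw [intervalIntegral.integral_sub ((hFc z z.continuous).intervalIntegrable _ _)
        ((hFc w w.continuous).intervalIntegrable _ _)]
      simp only [P, BoundedContinuousFunction.coe_ofNormedAddCommGroup]
      rw [← smul_sub, add_sub_add_left_eq_sub]
    rw [dist_eq_norm, h2]
    refine h1.trans (le_of_eq ?_)
    push_cast
    ring
  obtain ⟨z, hz⟩ : ∃ z, P z = z := ⟨_, hP.fixedPoint_isFixedPt⟩
  have hzt : ∀ t, T ≤ t → Real.exp (Λ t) • z t =
      x₀ + ∫ s in T..t, Real.exp (Λ s) • A s (z s) := by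
    intro t ht
    have h1 : z t = Real.exp (-Λ (max T t)) •
        (x₀ + ∫ s in T..max T t, Real.exp (Λ s) • A s (z s)) := by
      conv_lhs => rw [← hz]
      rfl
    rw [max_eq_right ht] at h1
    conv_lhs => rw [h1]
    rw [smul_smul, ← Real.exp_add]
    simp
  refine ⟨fun t => Real.exp (Λ t) • z t, (hzt T le_rfl).trans (by simp), fun t ht => ?_⟩
  rw [map_smul]
  exact ((hId z z.continuous t).const_add x₀).hasDerivWithinAt.congr hzt (hzt t ht)

/-- Global existence for linear equations on a half-line. -/
theorem exists_linear_solution {T : ℝ} {A : ℝ → E →L[ℝ] E} (hA : ContinuousOn A (Ici T))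
    (x₀ : E) :
    ∃ y : ℝ → E, y T = x₀ ∧ ∀ t ∈ Ici T, HasDerivWithinAt y (A t (y t)) (Ici T) t := by
  obtain ⟨y, h0, hy⟩ := exists_solution_of_continuous T (continuous_comp_max hA) x₀
  refine ⟨y, h0, fun t ht => ?_⟩
  have := hy t ht
  rwa [max_eq_right ht] at this

end LinearODE


/-! ### The invariant cone. -/

section Cone

/-- The coordinates in which the invariant cone of the Riccati equation is given by
nonnegativity. -/
def coneCoord (x : Quaternion ℝ) : Fin 4 → ℝ := ![x.re, -x.imI, -x.imJ, -x.imK]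

/-- By Cauchy–Schwarz the square of the mixed term is at most `4 α e s r`, which is at most `(α s +
e r) ^ 2`. -/
lemma discriminant_bound {α e p₁ p₂ p₃ v₁ v₂ v₃ s r : ℝ} (hα : 0 ≤ α) (he : 0 ≤ e)
    (hD : p₁ ^ 2 + p₂ ^ 2 + p₃ ^ 2 ≤ 4 * α * e)
    (hs : 0 ≤ s) (hr : 0 ≤ r) (hv : v₁ ^ 2 + v₂ ^ 2 + v₃ ^ 2 ≤ s * r) :
    0 ≤ α * s + (p₁ * v₁ + p₂ * v₂ + p₃ * v₃) + e * r := by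
  have h1 : (p₁ * v₁ + p₂ * v₂ + p₃ * v₃) ^ 2 ≤
      (p₁ ^ 2 + p₂ ^ 2 + p₃ ^ 2) * (v₁ ^ 2 + v₂ ^ 2 + v₃ ^ 2) := by
    nlinarith [sq_nonneg (p₁ * v₂ - p₂ * v₁), sq_nonneg (p₁ * v₃ - p₃ * v₁),
      sq_nonneg (p₂ * v₃ - p₃ * v₂)]
  have h2 : (p₁ ^ 2 + p₂ ^ 2 + p₃ ^ 2) * (v₁ ^ 2 + v₂ ^ 2 + v₃ ^ 2) ≤ 4 * α * e * (s * r) :=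
    mul_le_mul hD hv (by positivity) (by positivity)
  have h3 : 4 * α * e * (s * r) ≤ (α * s + e * r) ^ 2 := by
    nlinarith [sq_nonneg (α * s - e * r)]
  have h4 := abs_le_of_sq_le_sq' (h1.trans (h2.trans h3)) (by positivity)
  linarith [h4.1]

lemma norm_sq_eq_components (x : Quaternion ℝ) :
    ‖x‖ ^ 2 = x.re ^ 2 + x.imI ^ 2 + x.imJ ^ 2 + x.imK ^ 2 := by
  rw [pow_two, ← Quaternion.normSq_eq_norm_mul_self, Quaternion.normSq_def']

/-- The vector field points into the cone: the coordinates of `ψ φ̄`, for a solution `(φ, ψ)` of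
the linear system, satisfy linear differential inequalities. -/
lemma coneCoord_deriv_ge {a11 a12 a21 a22 : Quaternion ℝ} {n : Fin 4}
    (h0 : 0 ≤ comp a12 n) (hz : comp a12 n = 0 → ∀ m, pCoef (-a22) a11 n m = 0)
    (hD : disc a12 (-a22) a11 (-a21) n ≤ 0) (φ ψ : Quaternion ℝ) :
    (a11.re + a22.re) * coneCoord (ψ * star φ) n ≤
      coneCoord ((a21 * φ + a22 * ψ) * star φ + ψ * star (a11 * φ + a12 * ψ)) n := by
  have hX : ‖ψ * star φ‖ ^ 2 = ‖ψ‖ ^ 2 * ‖φ‖ ^ 2 := by rw [norm_mul, norm_star, mul_pow]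
  rw [norm_sq_eq_components (ψ * star φ)] at hX
  -- Since `d = -a21`, the sign in the discriminant is absorbed into `e`, and the hypothesis becomes
  -- `∑ p² ≤ 4 a e` with `e ≥ 0`, also in the degenerate case `a = 0`.
  obtain ⟨e, he⟩ : ∃ e, e = (if n = 0 then (1 : ℝ) else -1) * comp a21 n := ⟨_, rfl⟩
  have hE : 0 ≤ e ∧ pCoef (-a22) a11 n 0 ^ 2 + pCoef (-a22) a11 n 1 ^ 2 +
      pCoef (-a22) a11 n 2 ^ 2 ≤ 4 * comp a12 n * e := by
    have hcomp : comp (-a21) n = -comp a21 n := by fin_cases n <;> simp [comp]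
    have hD' : disc a12 (-a22) a11 (-a21) n = if comp a12 n ≠ 0 then pCoef (-a22) a11 n 0 ^ 2 +
        pCoef (-a22) a11 n 1 ^ 2 + pCoef (-a22) a11 n 2 ^ 2 - 4 * comp a12 n * e
        else -(4 * e) := by
      simp only [disc, hcomp, Fin.sum_univ_three, he]
      split_ifs <;> ring
    rw [hD'] at hD
    split_ifs at hD with h
    · have hpos := lt_of_le_of_ne h0 (Ne.symm h)
      refine ⟨?_, by linarith⟩
      by_contra! hneg
      nlinarith [mul_neg_of_pos_of_neg hpos hneg, sq_nonneg (pCoef (-a22) a11 n 0),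
        sq_nonneg (pCoef (-a22) a11 n 1), sq_nonneg (pCoef (-a22) a11 n 2)]
    · have hc : comp a12 n = 0 := not_not.1 h
      simp only [hz hc, hc]
      constructor <;> linarith
  -- The `vᵢ` are, up to order and sign, the three components of `ψ * star φ` other than the one
  -- being differentiated; their squares sum to at most `‖ψ * star φ‖ ^ 2`.
  obtain ⟨v₁, v₂, v₃, hv, hid⟩ : ∃ v₁ v₂ v₃ : ℝ, v₁ ^ 2 + v₂ ^ 2 + v₃ ^ 2 ≤ ‖ψ‖ ^ 2 * ‖φ‖ ^ 2 ∧
      coneCoord ((a21 * φ + a22 * ψ) * star φ + ψ * star (a11 * φ + a12 * ψ)) n =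
        (a11.re + a22.re) * coneCoord (ψ * star φ) n + (comp a12 n * ‖ψ‖ ^ 2 +
          (pCoef (-a22) a11 n 0 * v₁ + pCoef (-a22) a11 n 1 * v₂ + pCoef (-a22) a11 n 2 * v₃) +
          e * ‖φ‖ ^ 2) := by
    have hφ := norm_sq_eq_components φ
    have hψ := norm_sq_eq_components ψ
    set X := ψ * star φ with hXdef
    fin_cases n
    · refine ⟨X.imI, X.imJ, X.imK, by nlinarith [sq_nonneg X.re], ?_⟩
      rw [hφ, hψ, he, hXdef]
      simp [coneCoord, comp, pCoef]
      ring
    · refine ⟨X.re, X.imK, -X.imJ, by nlinarith [sq_nonneg X.imI], ?_⟩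
      rw [hφ, hψ, he, hXdef]
      simp [coneCoord, comp, pCoef]
      ring
    · refine ⟨-X.imK, X.re, X.imI, by nlinarith [sq_nonneg X.imJ], ?_⟩
      rw [hφ, hψ, he, hXdef]
      simp [coneCoord, comp, pCoef]
      ring
    · refine ⟨X.imJ, -X.imI, X.re, by nlinarith [sq_nonneg X.imK], ?_⟩
      rw [hφ, hψ, he, hXdef]
      simp [coneCoord, comp, pCoef]
      ring
  rw [hid]
  have := discriminant_bound h0 hE.1 hE.2
    (sq_nonneg ‖ψ‖) (sq_nonneg ‖φ‖) hv
  linarith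

lemma re_mul_eq_sum (a x : Quaternion ℝ) :
    (a * x).re = ∑ n, comp a n * coneCoord x n := by
  simp [Fin.sum_univ_four, comp, coneCoord]
  ring

lemma hasDerivWithinAt_coneCoord {f : ℝ → Quaternion ℝ} {f' : Quaternion ℝ} {s : Set ℝ} {t : ℝ}
    (h : HasDerivWithinAt f f' s t) (n : Fin 4) :
    HasDerivWithinAt (fun t => coneCoord (f t) n) (coneCoord f' n) s t := by
  obtain ⟨e, he⟩ : ∃ e : Quaternion ℝ, ∀ x, coneCoord x n = inner ℝ e x := by
    have hin : ∀ e x : Quaternion ℝ, inner ℝ e x =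
        e.re * x.re + e.imI * x.imI + e.imJ * x.imJ + e.imK * x.imK := fun e x => by
      rw [Quaternion.inner_def]
      simp
    fin_cases n
    · exact ⟨⟨1, 0, 0, 0⟩, fun x => ((hin _ x).trans (by simp [coneCoord])).symm⟩
    · exact ⟨⟨0, -1, 0, 0⟩, fun x => ((hin _ x).trans (by simp [coneCoord])).symm⟩
    · exact ⟨⟨0, 0, -1, 0⟩, fun x => ((hin _ x).trans (by simp [coneCoord])).symm⟩
    · exact ⟨⟨0, 0, 0, -1⟩, fun x => ((hin _ x).trans (by simp [coneCoord])).symm⟩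
  simp only [he]
  exact ((innerSL ℝ e).hasFDerivAt.comp_hasDerivWithinAt t h).congr_deriv (by simp)

lemma hasDerivWithinAt_star {f : ℝ → Quaternion ℝ} {f' : Quaternion ℝ} {s : Set ℝ} {t : ℝ}
    (h : HasDerivWithinAt f f' s t) : HasDerivWithinAt (fun t => star (f t)) (star f') s t := by
  let L : Quaternion ℝ →ₗ[ℝ] Quaternion ℝ :=
    { toFun := star, map_add' := star_add, map_smul' := fun r x => by simp }
  exact L.toContinuousLinearMap.hasFDerivAt.comp_hasDerivWithinAt t h

lemma continuousOn_re {f : ℝ → Quaternion ℝ} {s : Set ℝ} (h : ContinuousOn f s) :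
    ContinuousOn (fun t => (f t).re) s :=
  Quaternion.continuous_re.comp_continuousOn h

end Cone

/-! ### Existence and norm formulas for the quaternionic linear equations. -/

section Linear

variable {T : ℝ}

/-- Left multiplication by continuous coefficients: global existence for `f' = M f`. -/
lemma exists_left_linear_solution {M : ℝ → Quaternion ℝ} (hM : ContinuousOn M (Ici T))
    (x₀ : Quaternion ℝ) : ∃ f : ℝ → Quaternion ℝ, f T = x₀ ∧
      ∀ t ∈ Ici T, HasDerivWithinAt f (M t * f t) (Ici T) t :=
  exists_linear_solution (A := fun t => ContinuousLinearMap.mul ℝ (Quaternion ℝ) (M t))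
    ((ContinuousLinearMap.mul ℝ (Quaternion ℝ)).continuous.comp_continuousOn hM) x₀

/-- Right multiplication by continuous coefficients: global existence for `f' = f M`. -/
lemma exists_right_linear_solution {M : ℝ → Quaternion ℝ} (hM : ContinuousOn M (Ici T))
    (x₀ : Quaternion ℝ) : ∃ f : ℝ → Quaternion ℝ, f T = x₀ ∧
      ∀ t ∈ Ici T, HasDerivWithinAt f (f t * M t) (Ici T) t :=
  exists_linear_solution (A := fun t => (ContinuousLinearMap.mul ℝ (Quaternion ℝ)).flip (M t))
    ((ContinuousLinearMap.mul ℝ (Quaternion ℝ)).flip.continuous.comp_continuousOn hM) x₀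

lemma exists_isSysSol {a11 a12 a21 a22 : ℝ → Quaternion ℝ}
    (ha11 : ContinuousOn a11 (Ici T)) (ha12 : ContinuousOn a12 (Ici T))
    (ha21 : ContinuousOn a21 (Ici T)) (ha22 : ContinuousOn a22 (Ici T)) (x₀ y₀ : Quaternion ℝ) :
    ∃ φ ψ : ℝ → Quaternion ℝ, IsSysSol T a11 a12 a21 a22 φ ψ ∧ φ T = x₀ ∧ ψ T = y₀ := by
  let H := Quaternion ℝ
  let L := ContinuousLinearMap.mul ℝ H
  let P₁ := ContinuousLinearMap.fst ℝ H H
  let P₂ := ContinuousLinearMap.snd ℝ H H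
  let I₁ := ContinuousLinearMap.inl ℝ H H
  let I₂ := ContinuousLinearMap.inr ℝ H H
  have hL : ∀ {M : ℝ → H}, ContinuousOn M (Ici T) → ContinuousOn (fun t => L (M t)) (Ici T) :=
    fun h => L.continuous.comp_continuousOn h
  obtain ⟨y, h0, hy⟩ := exists_linear_solution (E := H × H) (T := T)
    (A := fun t => I₁ ∘L (L (a11 t) ∘L P₁ + L (a12 t) ∘L P₂) +
      I₂ ∘L (L (a21 t) ∘L P₁ + L (a22 t) ∘L P₂))
    (((continuousOn_const.clm_comp (((hL ha11).clm_comp continuousOn_const).add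
      ((hL ha12).clm_comp continuousOn_const)))).add
      (continuousOn_const.clm_comp (((hL ha21).clm_comp continuousOn_const).add
      ((hL ha22).clm_comp continuousOn_const)))) (x₀, y₀)
  refine ⟨fun t => (y t).1, fun t => (y t).2, fun t ht => ⟨?_, ?_⟩, by simp [h0], by simp [h0]⟩
  · exact (P₁.hasFDerivAt.comp_hasDerivWithinAt t (hy t ht)).congr_deriv
      (by simp [P₁, I₁, I₂, P₂, L])
  · exact (P₂.hasFDerivAt.comp_hasDerivWithinAt t (hy t ht)).congr_deriv
      (by simp [P₁, I₁, I₂, P₂, L])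

lemma inner_mul_left_self (m x : Quaternion ℝ) : inner ℝ x (m * x) = m.re * ‖x‖ ^ 2 := by
  rw [norm_sq_eq_components, Quaternion.inner_def]
  simp
  ring

lemma inner_mul_right_self (m x : Quaternion ℝ) : inner ℝ x (x * m) = m.re * ‖x‖ ^ 2 := by
  rw [norm_sq_eq_components, Quaternion.inner_def]
  simp
  ring

lemma norm_eq_of_left_linear {M f : ℝ → Quaternion ℝ} (hM : ContinuousOn M (Ici T))
    (h : ∀ t ∈ Ici T, HasDerivWithinAt f (M t * f t) (Ici T) t) {t : ℝ} (ht : T ≤ t) :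
    ‖f t‖ = ‖f T‖ * Real.exp (∫ s in T..t, (M s).re) :=
  norm_eq_exp_integral h (continuousOn_re hM) (fun _ _ => inner_mul_left_self _ _) ht

lemma norm_eq_of_right_linear {M f : ℝ → Quaternion ℝ} (hM : ContinuousOn M (Ici T))
    (h : ∀ t ∈ Ici T, HasDerivWithinAt f (f t * M t) (Ici T) t) {t : ℝ} (ht : T ≤ t) :
    ‖f t‖ = ‖f T‖ * Real.exp (∫ s in T..t, (M s).re) :=
  norm_eq_exp_integral h (continuousOn_re hM) (fun _ _ => inner_mul_right_self _ _) ht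

end Linear


/-! ### Construction of the reference solution. -/

section Reference

variable {t₀ T : ℝ} {a11 a12 a21 a22 : ℝ → Quaternion ℝ}

lemma IsSysSol.mono {φ ψ : ℝ → Quaternion ℝ} (h : IsSysSol t₀ a11 a12 a21 a22 φ ψ) (hT : t₀ ≤ T) :
    IsSysSol T a11 a12 a21 a22 φ ψ := fun t ht =>
  ⟨hasDerivWithinAt_Ici_mono (h t (hT.trans ht)).1 hT,
    hasDerivWithinAt_Ici_mono (h t (hT.trans ht)).2 hT⟩

lemma IsRegularSol.mono {a b c d q : ℝ → Quaternion ℝ} (h : IsRegularSol a b c d t₀ q)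
    (hT : t₀ ≤ T) : IsRegularSol a b c d T q := fun t ht =>
  hasDerivWithinAt_Ici_mono (h t (hT.trans ht)) hT

/-- The usual linearisation: the derivative of `ψ φ⁻¹` is `ψ' φ⁻¹ - ψ φ⁻¹ φ' φ⁻¹`. -/
lemma IsSysSol.isRegularSol {φ ψ : ℝ → Quaternion ℝ} (h : IsSysSol T a11 a12 a21 a22 φ ψ)
    (h0 : ∀ t ≥ T, φ t ≠ 0) :
    IsRegularSol a12 (-a22) a11 (-a21) T (fun t => ψ t * (φ t)⁻¹) := by
  intro t ht
  refine ((h t ht).2.mul (hasDerivWithinAt_inv_quaternion (h t ht).1 (h0 t ht))).congr_deriv ?_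
  have h1 : φ t * (φ t)⁻¹ = 1 := mul_inv_cancel₀ (h0 t ht)
  simp only [add_mul, mul_add, neg_add, mul_neg, neg_mul, mul_assoc, h1, mul_one, Pi.neg_apply,
    neg_neg]
  abel

/-- A globally defined solution `q` of the Riccati equation together with the associated solutions
`φ`, `χ` of `φ' = (a q + c) φ` and `χ' = χ (b + q a)`, a primitive `μ` of `φ⁻¹ a χ⁻¹` and its
limit `ν`, satisfying the norm estimates valid in the invariant cone. -/
structure IsReference (t₀ : ℝ) (a11 a12 a21 a22 q φ χ μ : ℝ → Quaternion ℝ) (ν : Quaternion ℝ) :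
    Prop where
  regular : IsRegularSol a12 (-a22) a11 (-a21) t₀ q
  phi : IsPhi a12 a11 q t₀ φ
  psi : IsPsi a12 (-a22) q t₀ χ
  phi_ne : ∀ t ≥ t₀, φ t ≠ 0
  psi_ne : ∀ t ≥ t₀, χ t ≠ 0
  primitive : ∀ t ∈ Ici t₀, HasDerivWithinAt μ ((φ t)⁻¹ * a12 t * (χ t)⁻¹) (Ici t₀) t
  limit : Tendsto μ atTop (𝓝 ν)
  exp_le : ∀ t ≥ t₀, Real.exp (∫ s in t₀..t, (a11 s).re) ≤ ‖φ t‖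
  norm_psi : ∀ t ≥ t₀, ‖χ t‖ * Real.exp (∫ s in t₀..t, ((a11 s).re + (a22 s).re)) = ‖φ t‖

theorem exists_isReference (ha11 : ContinuousOn a11 (Ici t₀)) (ha12 : ContinuousOn a12 (Ici t₀))
    (ha21 : ContinuousOn a21 (Ici t₀)) (ha22 : ContinuousOn a22 (Ici t₀))
    (S : Finset (Fin 4))
    (hα_nonneg : ∀ n ∈ S, ∀ t ≥ t₀, 0 ≤ comp (a12 t) n)
    (hα_zero : ∀ n ∈ S, ∀ t ≥ t₀, comp (a12 t) n = 0 →
      ∀ m, pCoef (-a22 t) (a11 t) n m = 0)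
    (hα_compl : ∀ n ∉ S, ∀ t ≥ t₀, comp (a12 t) n = 0)
    (hα_disc : ∀ n, ∀ t ≥ t₀, disc (a12 t) (-a22 t) (a11 t) (-a21 t) n ≤ 0)
    (hβ : IntegrableOn
      (fun τ => ‖a12 τ‖ * Real.exp (∫ s in t₀..τ, ((a22 s).re - (a11 s).re))) (Ioi t₀)) :
    ∃ q φ χ μ ν, IsReference t₀ a11 a12 a21 a22 q φ χ μ ν := by
  -- With `ψ t₀ = 0` the cone coordinates start at zero, the vertex of the cone.
  obtain ⟨φ, ψ, hsys, hφ0, hψ0⟩ := exists_isSysSol ha11 ha12 ha21 ha22 1 0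
  have r11 := continuousOn_re ha11
  have r22 := continuousOn_re ha22
  have hcone : ∀ n ∈ S, ∀ t ≥ t₀, 0 ≤ coneCoord (ψ t * star (φ t)) n := by
    intro n hn t ht
    have hm : coneCoord (ψ t₀ * star (φ t₀)) n *
          Real.exp (-∫ s in t₀..t₀, ((a11 s).re + (a22 s).re)) ≤ coneCoord (ψ t * star (φ t)) n *
          Real.exp (-∫ s in t₀..t, ((a11 s).re + (a22 s).re)) := monotoneOn_mul_exp_neg_integral
      (fun t ht => hasDerivWithinAt_coneCoord
        ((hsys t ht).2.mul (hasDerivWithinAt_star (hsys t ht).1)) n)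
      (r11.add r22)
      (fun t ht => coneCoord_deriv_ge (hα_nonneg n hn t ht) (hα_zero n hn t ht) (hα_disc n t ht)
        (φ t) (ψ t)) self_mem_Ici ht ht
    have h0 : coneCoord (ψ t₀ * star (φ t₀)) n = 0 := by
      rw [hψ0]; fin_cases n <;> simp [coneCoord] <;> rfl
    rw [h0, zero_mul] at hm
    exact nonneg_of_mul_nonneg_left (b := Real.exp _) hm (Real.exp_pos _)
  -- This real part is a sum of products of components of `a12` and cone coordinates; outside `S`
  -- the factor from `a12` vanishes.
  have hre : ∀ t ≥ t₀, 0 ≤ (a12 t * (ψ t * star (φ t))).re := by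
    intro t ht
    rw [re_mul_eq_sum]
    refine Finset.sum_nonneg fun n _ => ?_
    by_cases hn : n ∈ S
    · exact mul_nonneg (hα_nonneg n hn t ht) (hcone n hn t ht)
    · rw [hα_compl n hn t ht, zero_mul]
  -- The derivative of `‖φ‖ ^ 2` is `2 Re a11 ‖φ‖ ^ 2 + 2 Re (a12 ψ φ̄)`, and the last term is
  -- nonnegative.
  have hexp : ∀ t ≥ t₀, Real.exp (∫ s in t₀..t, (a11 s).re) ≤ ‖φ t‖ := by
    intro t ht
    have hm := monotoneOn_mul_exp_neg_integral (T := t₀) (g := fun t => 2 * (a11 t).re)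
      (fun t ht => (hsys t ht).1.norm_sq) (r11.const_smul (2 : ℝ)) (fun t ht => by
        have h1 := hre t ht
        rw [inner_add_right, inner_mul_left_self, real_inner_comm, Quaternion.inner_def]
        rw [← mul_assoc] at h1
        linarith) self_mem_Ici ht ht
    simp only [hφ0, norm_one, one_pow, one_mul, intervalIntegral.integral_same, neg_zero,
      Real.exp_zero, intervalIntegral.integral_const_mul] at hm
    refine le_of_sq_le_sq ?_ (norm_nonneg _)
    rw [← Real.exp_nat_mul]
    calc _ = 1 * Real.exp (2 * ∫ s in t₀..t, (a11 s).re) := by simp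
      _ ≤ _ := mul_le_mul_of_nonneg_right hm (Real.exp_pos _).le
      _ = ‖φ t‖ ^ 2 := by rw [mul_assoc, ← Real.exp_add]; simp
  have hφne : ∀ t ≥ t₀, φ t ≠ 0 := fun t ht =>
    norm_pos_iff.1 ((Real.exp_pos _).trans_le (hexp t ht))
  have hq := hsys.isRegularSol hφne
  set q : ℝ → Quaternion ℝ := fun t => ψ t * (φ t)⁻¹ with hqdef
  have hqc : ContinuousOn q (Ici t₀) := continuousOn_of_hasDerivWithinAt hq
  have hφ : IsPhi a12 a11 q t₀ φ := ⟨hφ0, fun t ht => (hsys t ht).1.congr_deriv (by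
    simp only [hqdef, add_mul, mul_assoc, inv_mul_cancel₀ (hφne t ht), mul_one]
    rw [add_comm])⟩
  obtain ⟨χ, hχ0, hχ⟩ := exists_right_linear_solution (ha22.neg.add (hqc.mul ha12)) 1
  have hnφ : ∀ t ≥ t₀, ‖φ t‖ = Real.exp (∫ s in t₀..t, (a12 s * q s + a11 s).re) := by
    intro t ht
    rw [norm_eq_of_left_linear ((ha12.mul hqc).add ha11) hφ.2 ht, hφ0]
    simp
  have hnχ : ∀ t ≥ t₀, ‖χ t‖ = Real.exp (∫ s in t₀..t, (-a22 s + q s * a12 s).re) := by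
    intro t ht
    rw [norm_eq_of_right_linear (ha22.neg.add (hqc.mul ha12)) hχ ht, hχ0]
    simp
  have hχne : ∀ t ≥ t₀, χ t ≠ 0 := fun t ht => norm_pos_iff.1 (by
    rw [hnχ t ht]; exact Real.exp_pos _)
  have hint : ∀ {f : ℝ → ℝ}, ContinuousOn f (Ici t₀) → ∀ {t}, t₀ ≤ t →
      IntervalIntegrable f volume t₀ t := fun hf t ht =>
    (hf.mono (by rw [uIcc_of_le ht]; exact Icc_subset_Ici_self)).intervalIntegrable
  -- The growth rates of `φ` and `χ` differ by `Re a11 + Re a22`, because `Re (a q) = Re (q a)`.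
  have hnorm : ∀ t ≥ t₀,
      ‖χ t‖ * Real.exp (∫ s in t₀..t, ((a11 s).re + (a22 s).re)) = ‖φ t‖ := by
    intro t ht
    have hadd := intervalIntegral.integral_add (f := fun s => (-a22 s + q s * a12 s).re)
      (g := fun s => (a11 s).re + (a22 s).re)
      (hint (continuousOn_re (ha22.neg.add (hqc.mul ha12))) ht) (hint (r11.add r22) ht)
    rw [hnχ t ht, hnφ t ht, ← Real.exp_add, ← hadd]
    congr 1
    refine intervalIntegral.integral_congr fun s _ => ?_
    simp
    ring
  have hφc : ContinuousOn φ (Ici t₀) := continuousOn_of_hasDerivWithinAt hφ.2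
  have hχc : ContinuousOn χ (Ici t₀) := continuousOn_of_hasDerivWithinAt hχ
  have hFc : ContinuousOn (fun t => (φ t)⁻¹ * a12 t * (χ t)⁻¹) (Ici t₀) :=
    ((hφc.inv₀ hφne).mul ha12).mul (hχc.inv₀ hχne)
  -- The norm identity turns `‖φ⁻¹ a12 χ⁻¹‖` into `‖a12‖ exp (∫ Re (a11 + a22)) / ‖φ‖ ^ 2`; the
  -- lower bound for `‖φ‖` then gives the integrand of `hβ`.
  have hF : IntegrableOn (fun t => (φ t)⁻¹ * a12 t * (χ t)⁻¹) (Ioi t₀) := by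
    refine hβ.mono' ((hFc.mono Ioi_subset_Ici_self).aestronglyMeasurable measurableSet_Ioi) ?_
    refine (ae_restrict_iff' measurableSet_Ioi).2 (ae_of_all _ fun t ht => ?_)
    have ht' : t₀ ≤ t := le_of_lt ht
    rw [norm_mul, norm_mul, norm_inv, norm_inv]
    have e1 : Real.exp (∫ s in t₀..t, ((a22 s).re - (a11 s).re)) =
        Real.exp (∫ s in t₀..t, ((a11 s).re + (a22 s).re)) *
          (Real.exp (∫ s in t₀..t, (a11 s).re) ^ 2)⁻¹ := by
      rw [← Real.exp_nat_mul, ← Real.exp_neg, ← Real.exp_add,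
        intervalIntegral.integral_add (hint r11 ht') (hint r22 ht'),
        intervalIntegral.integral_sub (hint r22 ht') (hint r11 ht')]
      push_cast
      ring_nf
    have e2 : ‖χ t‖⁻¹ = Real.exp (∫ s in t₀..t, ((a11 s).re + (a22 s).re)) * ‖φ t‖⁻¹ := by
      have := norm_pos_iff.2 (hχne t ht')
      rw [← hnorm t ht']
      field_simp
    have e3 : (‖φ t‖ ^ 2)⁻¹ ≤ (Real.exp (∫ s in t₀..t, (a11 s).re) ^ 2)⁻¹ := by
      gcongr
      exact hexp t ht'
    rw [e1, e2]
    calc _ = ‖a12 t‖ * (Real.exp (∫ s in t₀..t, ((a11 s).re + (a22 s).re)) * (‖φ t‖ ^ 2)⁻¹) := by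
          rw [← inv_pow]; ring
      _ ≤ _ := by gcongr
  exact ⟨q, φ, χ, _, _, hq, hφ, ⟨hχ0, hχ⟩, hφne, hχne,
    fun t ht => hasDerivWithinAt_integral_Ici hFc ht,
    intervalIntegral_tendsto_integral_Ioi t₀ hF tendsto_id, hexp, hnorm⟩

end Reference


/-! ### Uniform bounds from limits at infinity. -/

section Bounds

variable {E : Type*} [NormedAddCommGroup E] {T : ℝ} {f : ℝ → E} {L : E}

lemma exists_norm_ge_of_tendsto_ne_zero (hf : ContinuousOn f (Ici T)) (hL : Tendsto f atTop (𝓝 L))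
    (hL0 : L ≠ 0) (h0 : ∀ t ≥ T, f t ≠ 0) : ∃ ε > 0, ∀ t ≥ T, ε ≤ ‖f t‖ := by
  have hev := hL.norm.eventually_const_le (half_lt_self (norm_pos_iff.2 hL0))
  obtain ⟨B, hB⟩ := eventually_atTop.1 (hev.and (eventually_ge_atTop T))
  obtain ⟨s, hs, hmin⟩ := isCompact_Icc.exists_isMinOn (nonempty_Icc.2 (hB B le_rfl).2)
    (hf.mono (fun _ hx => hx.1 : Icc T B ⊆ Ici T)).norm
  refine ⟨min (‖L‖ / 2) ‖f s‖, lt_min (half_pos (norm_pos_iff.2 hL0))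
    (norm_pos_iff.2 (h0 s hs.1)), fun t ht => ?_⟩
  rcases le_total B t with h | h
  · exact (min_le_left _ _).trans (hB t h).1
  · exact (min_le_right _ _).trans (hmin ⟨ht, h⟩)

lemma exists_norm_le_of_tendsto (hf : ContinuousOn f (Ici T)) (hL : Tendsto f atTop (𝓝 L)) :
    ∃ K ≥ 0, ∀ t ≥ T, ‖f t‖ ≤ K := by
  have hev := hL.norm.eventually_le_const (lt_add_one ‖L‖)
  obtain ⟨B, hB⟩ := eventually_atTop.1 hev
  obtain ⟨K, hK⟩ := isCompact_Icc.exists_bound_of_continuousOn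
    (hf.mono (fun _ hx => hx.1 : Icc T B ⊆ Ici T))
  refine ⟨max (‖L‖ + 1) K, by positivity, fun t ht => ?_⟩
  rcases le_total B t with h | h
  · exact (hB t h).trans (le_max_left _ _)
  · exact (hK t ⟨ht, h⟩).trans (le_max_right _ _)

end Bounds

/-! ### General solution, and normality in terms of coefficients. -/

section Connection

variable {t₀ T : ℝ} {a11 a12 a21 a22 q φ χ μ f g r : ℝ → Quaternion ℝ} {ν α β γ : Quaternion ℝ}

/-- The components `f`, `g` are the combination with right coefficients `α`, `β` of the
fundamental system attached to a reference solution, on `[T, +∞)`. -/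
def HasCoefficients (T : ℝ) (q φ χ μ f g : ℝ → Quaternion ℝ) (α β : Quaternion ℝ) : Prop :=
  ∀ t ≥ T, f t = φ t * (α + μ t * β) ∧ g t = q t * f t + (χ t)⁻¹ * β

/-- `φ⁻¹ f` for the solution `(f, g)` of the linear system with `f T = 1`, `g T = γ`, expressed
through the value `m` of `μ`. -/
def transfer (q φ χ μ : ℝ → Quaternion ℝ) (T : ℝ) (γ m : Quaternion ℝ) : Quaternion ℝ :=
  (φ T)⁻¹ + (m - μ T) * (χ T * (γ - q T))

lemma IsReference.hasDerivWithinAt_inv_phi (h : IsReference t₀ a11 a12 a21 a22 q φ χ μ ν) {t : ℝ}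
    (ht : t₀ ≤ t) :
    HasDerivWithinAt (fun t => (φ t)⁻¹) (-((φ t)⁻¹ * (a12 t * q t + a11 t))) (Ici t₀) t := by
  refine (hasDerivWithinAt_inv_quaternion (h.phi.2 t ht) (h.phi_ne t ht)).congr_deriv ?_
  simp only [mul_assoc, mul_inv_cancel₀ (h.phi_ne t ht), mul_one]

lemma IsReference.hasDerivWithinAt_inv_psi (h : IsReference t₀ a11 a12 a21 a22 q φ χ μ ν) {t : ℝ}
    (ht : t₀ ≤ t) :
    HasDerivWithinAt (fun t => (χ t)⁻¹) (-((-a22 t + q t * a12 t) * (χ t)⁻¹)) (Ici t₀) t := by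
  refine (hasDerivWithinAt_inv_quaternion (h.psi.2 t ht) (h.psi_ne t ht)).congr_deriv ?_
  simp only [← mul_assoc, inv_mul_cancel₀ (h.psi_ne t ht), one_mul, Pi.neg_apply]

lemma IsReference.isSysSol (h : IsReference t₀ a11 a12 a21 a22 q φ χ μ ν)
    (hc : HasCoefficients t₀ q φ χ μ f g α β) : IsSysSol t₀ a11 a12 a21 a22 f g := by
  have hf : ∀ t ∈ Ici t₀, HasDerivWithinAt f (a11 t * f t + a12 t * g t) (Ici t₀) t := by
    intro t ht
    have h1 := (h.phi.2 t ht).mul (((h.primitive t ht).mul_const β).const_add α)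
    refine (h1.congr (fun s hs => (hc s hs).1) (hc t ht).1).congr_deriv ?_
    rw [(hc t ht).2, (hc t ht).1]
    simp only [mul_assoc, mul_inv_cancel_left₀ (h.phi_ne t ht)]
    noncomm_ring
  refine fun t ht => ⟨hf t ht, ?_⟩
  have h1 := ((h.regular t ht).mul (hf t ht)).add
    ((h.hasDerivWithinAt_inv_psi ht).mul_const β)
  refine (h1.congr (fun s hs => (hc s hs).2) (hc t ht).2).congr_deriv ?_
  rw [(hc t ht).2]
  simp only [Pi.neg_apply]
  noncomm_ring

/-- Two quantities are conserved: `χ (g - q f)`, which is `β`, and then `φ⁻¹ f - μ β`, which is `α`.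
-/
lemma IsReference.hasCoefficients (h : IsReference t₀ a11 a12 a21 a22 q φ χ μ ν) (hT : t₀ ≤ T)
    (hs : IsSysSol T a11 a12 a21 a22 f g) :
    HasCoefficients T q φ χ μ f g ((φ T)⁻¹ * f T - μ T * (χ T * (g T - q T * f T)))
      (χ T * (g T - q T * f T)) := by
  set β := χ T * (g T - q T * f T) with hβ
  have h1 : ∀ t ≥ T, χ t * (g t - q t * f t) = β := by
    intro t ht
    refine eq_of_hasDerivWithinAt_zero (f := fun t => χ t * (g t - q t * f t)) (fun s hsT => ?_) ht
    have hs0 : s ∈ Ici t₀ := hT.trans hsT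
    have h2 := (hasDerivWithinAt_Ici_mono (h.psi.2 s hs0) hT).mul ((hs s hsT).2.sub
      ((hasDerivWithinAt_Ici_mono (h.regular s hs0) hT).mul (hs s hsT).1))
    refine h2.congr_deriv ?_
    simp only [Pi.neg_apply, Pi.sub_apply, Pi.mul_apply]
    noncomm_ring
  have hg : ∀ t ≥ T, g t = q t * f t + (χ t)⁻¹ * β := by
    intro t ht
    rw [← h1 t ht, inv_mul_cancel_left₀ (h.psi_ne t (hT.trans ht))]
    abel
  refine fun t ht => ⟨?_, hg t ht⟩
  have h3 : (φ t)⁻¹ * f t - μ t * β = (φ T)⁻¹ * f T - μ T * β := by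
    refine eq_of_hasDerivWithinAt_zero (f := fun t => (φ t)⁻¹ * f t - μ t * β)
      (fun s hsT => ?_) ht
    have hs0 : s ∈ Ici t₀ := hT.trans hsT
    have h2 := ((hasDerivWithinAt_Ici_mono (h.hasDerivWithinAt_inv_phi hs0) hT).mul
      (hs s hsT).1).sub ((hasDerivWithinAt_Ici_mono (h.primitive s hs0) hT).mul_const β)
    refine h2.congr_deriv ?_
    rw [hg s hsT]
    noncomm_ring
  rw [← h3, sub_add_cancel, mul_inv_cancel_left₀ (h.phi_ne t (hT.trans ht))]

lemma IsReference.continuousOn_primitive (h : IsReference t₀ a11 a12 a21 a22 q φ χ μ ν)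
    (hT : t₀ ≤ T) : ContinuousOn μ (Ici T) :=
  (continuousOn_of_hasDerivWithinAt h.primitive).mono (Ici_subset_Ici.2 hT)

lemma IsReference.tendsto_transfer (h : IsReference t₀ a11 a12 a21 a22 q φ χ μ ν) :
    Tendsto (fun t => transfer q φ χ μ T γ (μ t)) atTop (𝓝 (transfer q φ χ μ T γ ν)) :=
  tendsto_const_nhds.add ((h.limit.sub_const _).mul_const _)

lemma IsPhi.isSysSol (hr : IsRegularSol a12 (-a22) a11 (-a21) T r) (hf : IsPhi a12 a11 r T f) :
    IsSysSol T a11 a12 a21 a22 f (fun t => r t * f t) := by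
  refine fun t ht => ⟨(hf.2 t ht).congr_deriv (by noncomm_ring), ?_⟩
  refine ((hr t ht).mul (hf.2 t ht)).congr_deriv ?_
  simp only [Pi.neg_apply]
  noncomm_ring

lemma IsReference.phi_eq_transfer (h : IsReference t₀ a11 a12 a21 a22 q φ χ μ ν) (hT : t₀ ≤ T)
    (hr : IsRegularSol a12 (-a22) a11 (-a21) T r) (hf : IsPhi a12 a11 r T f) {t : ℝ} (ht : T ≤ t) :
    f t = φ t * transfer q φ χ μ T (r T) (μ t) ∧
      r t * f t = q t * f t + (χ t)⁻¹ * (χ T * (r T - q T)) := by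
  have h1 := h.hasCoefficients hT (hf.isSysSol hr) t ht
  simp only [hf.1, mul_one] at h1
  refine ⟨h1.1.trans ?_, h1.2⟩
  rw [transfer]
  noncomm_ring

/-- The Riccati solution from `γ` is `g f⁻¹` for the system solution from `(1, γ)`, and `f` equals
`φ` times the transfer function; a zero of the latter is a blow-up. -/
lemma IsReference.exists_regular_iff (h : IsReference t₀ a11 a12 a21 a22 q φ χ μ ν) (hT : t₀ ≤ T)
    (ha11 : ContinuousOn a11 (Ici t₀)) (ha12 : ContinuousOn a12 (Ici t₀)) :
    (∃ r, IsRegularSol a12 (-a22) a11 (-a21) T r ∧ r T = γ) ↔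
      ∀ t ≥ T, transfer q φ χ μ T γ (μ t) ≠ 0 := by
  constructor
  · rintro ⟨r, hr, rfl⟩ t ht h0
    have hM : ContinuousOn (fun t => a12 t * r t + a11 t) (Ici T) :=
      ((ha12.mono (Ici_subset_Ici.2 hT)).mul (continuousOn_of_hasDerivWithinAt hr)).add
        (ha11.mono (Ici_subset_Ici.2 hT))
    obtain ⟨f, hf⟩ := exists_left_linear_solution hM 1
    have h1 := norm_eq_of_left_linear hM hf.2 ht
    rw [(h.phi_eq_transfer hT hr hf ht).1, h0, mul_zero, norm_zero, hf.1, norm_one, one_mul] at h1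
    exact (Real.exp_pos _).ne h1
  · intro h0
    set β := χ T * (γ - q T) with hβ
    set f : ℝ → Quaternion ℝ := fun t => φ t * ((φ T)⁻¹ - μ T * β + μ t * β) with hf
    have hc : HasCoefficients t₀ q φ χ μ f (fun t => q t * f t + (χ t)⁻¹ * β)
      ((φ T)⁻¹ - μ T * β) β := fun t _ => ⟨rfl, rfl⟩
    have hft : ∀ t, f t = φ t * transfer q φ χ μ T γ (μ t) := fun t => by
      rw [hf, transfer, ← hβ]
      noncomm_ring
    have hfT : f T = 1 := by
      rw [hft, transfer, sub_self, zero_mul, add_zero, mul_inv_cancel₀ (h.phi_ne T hT)]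
    refine ⟨_, ((h.isSysSol hc).mono hT).isRegularSol fun t ht => ?_, ?_⟩
    · rw [hft]
      exact mul_ne_zero (h.phi_ne t (hT.trans ht)) (h0 t ht)
    · simp only [hfT, hβ, inv_mul_cancel_left₀ (h.psi_ne T hT)]
      simp

lemma IsReference.isNormalSol_iff (h : IsReference t₀ a11 a12 a21 a22 q φ χ μ ν) (hT : t₀ ≤ T)
    (ha11 : ContinuousOn a11 (Ici t₀)) (ha12 : ContinuousOn a12 (Ici t₀))
    (hr : IsRegularSol a12 (-a22) a11 (-a21) T r) :
    IsNormalSol a12 (-a22) a11 (-a21) T r ↔ transfer q φ χ μ T (r T) ν ≠ 0 := by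
  simp only [IsNormalSol, hr, true_and, h.exists_regular_iff hT ha11 ha12]
  have hr0 := (h.exists_regular_iff hT ha11 ha12).1 ⟨r, hr, rfl⟩
  have hχT := h.psi_ne T hT
  have hφT := h.phi_ne T hT
  have hμc := h.continuousOn_primitive hT
  constructor
  · rintro ⟨U, hU, hreg⟩ h0
    have hm : ν - μ T ≠ 0 := fun hm => by
      rw [transfer, hm, zero_mul, add_zero] at h0
      exact inv_ne_zero hφT h0
    -- These are the initial values whose transfer function vanishes at time `t`. They converge to
    -- `r T`, so every neighbourhood contains a solution that blows up.
    have hlim : Tendsto (fun t => q T - (χ T)⁻¹ * ((μ t - μ T)⁻¹ * (φ T)⁻¹)) atTop (𝓝 (r T)) := by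
      have h1 : r T = q T - (χ T)⁻¹ * ((ν - μ T)⁻¹ * (φ T)⁻¹) := by
        rw [eq_neg_of_add_eq_zero_left h0, mul_neg, inv_mul_cancel_left₀ hm, mul_neg,
          inv_mul_cancel_left₀ hχT]
        abel
      rw [h1]
      exact (((((h.limit.sub_const _).inv₀ hm).mul_const _).const_mul _).const_sub _)
    have hne : ∀ᶠ t in atTop, μ t - μ T ≠ 0 := (h.limit.sub_const _).eventually_ne hm
    obtain ⟨t, htU, htm, htT⟩ := ((hlim.eventually hU).and
      (hne.and (eventually_ge_atTop T))).exists
    refine hreg _ htU t htT ?_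
    rw [transfer, sub_sub_cancel_left, mul_neg, mul_neg, mul_inv_cancel_left₀ hχT,
      mul_inv_cancel_left₀ htm, add_neg_cancel]
  · intro h0
    obtain ⟨ε, hε, hge⟩ := exists_norm_ge_of_tendsto_ne_zero
      (continuousOn_const.add ((hμc.sub continuousOn_const).mul continuousOn_const))
      h.tendsto_transfer h0 hr0
    obtain ⟨K, hK, hle⟩ := exists_norm_le_of_tendsto (hμc.sub continuousOn_const)
      (h.limit.sub_const (μ T))
    -- Moving the initial value by less than this radius changes the transfer function by less than
    -- its lower bound `ε`; the `+ 1` avoids dividing by zero.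
    have hpos : 0 < ε / (K * ‖χ T‖ + 1) := by positivity
    refine ⟨_, Metric.ball_mem_nhds _ hpos, fun γ hγ t ht hz => ?_⟩
    rw [mem_ball_iff_norm] at hγ
    have h1 : transfer q φ χ μ T (r T) (μ t) = -((μ t - μ T) * (χ T * (γ - r T))) := by
      rw [← sub_zero (transfer q φ χ μ T (r T) (μ t)), ← hz, transfer, transfer]
      noncomm_ring
    have h2 := hge t ht
    change ε ≤ ‖transfer q φ χ μ T (r T) (μ t)‖ at h2
    rw [h1, norm_neg, norm_mul, norm_mul, ← mul_assoc] at h2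
    have h3 : ‖μ t - μ T‖ * ‖χ T‖ * ‖γ - r T‖ ≤ (K * ‖χ T‖) * (ε / (K * ‖χ T‖ + 1)) := by
      gcongr
      exact hle t ht
    have h4 : (K * ‖χ T‖ + 1) * (ε / (K * ‖χ T‖ + 1)) = ε := by
      field_simp
    nlinarith

/-- The transfer function at `ν`, multiplied on the right by `f T`, equals `α + ν β`. The criterion
no longer depends on `T`. -/
lemma IsReference.isNormalSol_iff_of_hasCoefficients
    (h : IsReference t₀ a11 a12 a21 a22 q φ χ μ ν) (hT : t₀ ≤ T)
    (ha11 : ContinuousOn a11 (Ici t₀)) (ha12 : ContinuousOn a12 (Ici t₀))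
    (hc : HasCoefficients t₀ q φ χ μ f g α β) (h0 : ∀ t ≥ T, f t ≠ 0) :
    IsNormalSol a12 (-a22) a11 (-a21) T (fun t => g t * (f t)⁻¹) ↔ α + ν * β ≠ 0 := by
  rw [h.isNormalSol_iff hT ha11 ha12 (((h.isSysSol hc).mono hT).isRegularSol h0)]
  have hf := h0 T le_rfl
  have h1 : transfer q φ χ μ T (g T * (f T)⁻¹) ν * f T = α + ν * β := by
    have h2 : χ T * ((g T * (f T)⁻¹ - q T) * f T) = β := by
      rw [sub_mul, inv_mul_cancel_right₀ hf, (hc T hT).2, add_sub_cancel_left,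
        mul_inv_cancel_left₀ (h.psi_ne T hT)]
    rw [transfer, add_mul, mul_assoc, mul_assoc, h2, (hc T hT).1,
      inv_mul_cancel_left₀ (h.phi_ne T hT)]
    noncomm_ring
  rw [← h1, mul_ne_zero_iff]
  exact (and_iff_left hf).symm

/-- For an extremal solution the transfer function vanishes at `ν`, while regularity forbids a zero
at any `μ t`. -/
lemma IsReference.ne_of_isExtremalSol (h : IsReference t₀ a11 a12 a21 a22 q φ χ μ ν)
    (hT : t₀ ≤ T) (ha11 : ContinuousOn a11 (Ici t₀)) (ha12 : ContinuousOn a12 (Ici t₀))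
    (hr : IsExtremalSol a12 (-a22) a11 (-a21) T r) : ∀ t ≥ T, μ t ≠ ν := by
  intro t ht hμ
  have h1 := hr.2
  rw [h.isNormalSol_iff hT ha11 ha12 hr.1, not_not, ← hμ] at h1
  exact (h.exists_regular_iff hT ha11 ha12).1 ⟨r, hr.1, rfl⟩ t ht h1

lemma IsReference.isPrincipalAt (h : IsReference t₀ a11 a12 a21 a22 q φ χ μ ν)
    (hT : t₀ ≤ T) (ha11 : ContinuousOn a11 (Ici t₀)) (ha12 : ContinuousOn a12 (Ici t₀))
    (hc : HasCoefficients t₀ q φ χ μ f g (-(ν * β)) β) (hβ : β ≠ 0) (hne : ∀ t ≥ T, μ t ≠ ν) :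
    IsPrincipalAt t₀ a11 a12 a21 a22 T f g := by
  have hf : ∀ t ≥ T, f t ≠ 0 := fun t ht => by
    rw [(hc t (hT.trans ht)).1, neg_add_eq_sub, ← sub_mul]
    exact mul_ne_zero (h.phi_ne t (hT.trans ht)) (mul_ne_zero (sub_ne_zero.2 (hne t ht)) hβ)
  refine ⟨⟨h.isSysSol hc, hf⟩, ((h.isSysSol hc).mono hT).isRegularSol hf, ?_⟩
  rw [h.isNormalSol_iff_of_hasCoefficients hT ha11 ha12 hc hf]
  simp

lemma IsReference.hasCoefficients_of_isPrincipal (h : IsReference t₀ a11 a12 a21 a22 q φ χ μ ν)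
    (ha11 : ContinuousOn a11 (Ici t₀)) (ha12 : ContinuousOn a12 (Ici t₀))
    (hp : IsPrincipal t₀ a11 a12 a21 a22 f g) :
    ∃ β ≠ 0, HasCoefficients t₀ q φ χ μ f g (-(ν * β)) β := by
  obtain ⟨T, hT, ⟨hs, hf⟩, hr, hn⟩ := hp
  have hc := h.hasCoefficients le_rfl hs
  set β := χ t₀ * (g t₀ - q t₀ * f t₀)
  rw [h.isNormalSol_iff_of_hasCoefficients hT ha11 ha12 hc hf, not_not] at hn
  rw [eq_neg_of_add_eq_zero_left hn] at hc
  refine ⟨β, fun h0 => hf T le_rfl ?_, hc⟩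
  rw [(hc T hT).1, h0]
  simp

lemma IsReference.hasCoefficients_of_isNonPrincipalAt
    (h : IsReference t₀ a11 a12 a21 a22 q φ χ μ ν) (hT : t₀ ≤ T)
    (ha11 : ContinuousOn a11 (Ici t₀)) (ha12 : ContinuousOn a12 (Ici t₀))
    (hp : IsNonPrincipalAt t₀ a11 a12 a21 a22 T f g) :
    ∃ α β, HasCoefficients t₀ q φ χ μ f g α β ∧ α + ν * β ≠ 0 := by
  have hc := h.hasCoefficients le_rfl hp.1.1
  exact ⟨_, _, hc, (h.isNormalSol_iff_of_hasCoefficients hT ha11 ha12 hc hp.1.2).1 hp.2⟩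

end Connection


/-! ### The dichotomy, and asymptotics of principal and non-principal solutions. -/

section Extremal

variable {t₀ T : ℝ} {a11 a12 a21 a22 q φ χ μ f g f₂ g₂ r p F G : ℝ → Quaternion ℝ}
  {ν α β α₂ β₂ L : Quaternion ℝ}

lemma integral_eq_sub_of_hasDerivWithinAt_Ici
    (hF : ∀ t ∈ Ici T, HasDerivWithinAt F (G t) (Ici T) t) (hG : ContinuousOn G (Ici T)) {t : ℝ}
    (ht : T ≤ t) : ∫ s in T..t, G s = F t - F T := by
  have h1 := eq_of_hasDerivWithinAt_zero (f := fun t => (∫ s in T..t, G s) - F t)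
    (fun s hs => ((hasDerivWithinAt_integral_Ici hG hs).sub (hF s hs)).congr_deriv (sub_self _)) ht
  simp only [intervalIntegral.integral_same, zero_sub] at h1
  rw [sub_eq_iff_eq_add] at h1
  rw [h1]
  abel

lemma hasImproperIntegral_of_tendsto (hF : ∀ t ∈ Ici T, HasDerivWithinAt F (G t) (Ici T) t)
    (hG : ContinuousOn G (Ici T)) (hL : Tendsto F atTop (𝓝 L)) {t : ℝ} (ht : T ≤ t) :
    HasImproperIntegral G t (L - F t) := by
  refine (hL.sub_const (F t)).congr' ?_
  filter_upwards [eventually_ge_atTop t] with s hs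
  exact (integral_eq_sub_of_hasDerivWithinAt_Ici
    (fun x hx => hasDerivWithinAt_Ici_mono (hF x (ht.trans hx)) ht)
    (hG.mono (Ici_subset_Ici.2 ht)) hs).symm

/-- The reference solution itself is a witness: after renormalising `φ` and `χ` at `T`, its tail
integral from `t` is `φ T (ν - μ t) χ T`. -/
lemma IsReference.eqExtremal (h : IsReference t₀ a11 a12 a21 a22 q φ χ μ ν)
    (ha12 : ContinuousOn a12 (Ici t₀)) (hT : t₀ ≤ T) (hne : ∀ t ≥ T, μ t ≠ ν) :
    EqExtremal t₀ a12 (-a22) a11 (-a21) := by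
  have hφT := h.phi_ne T hT
  have hχT := h.psi_ne T hT
  have hφc : ContinuousOn φ (Ici T) :=
    (continuousOn_of_hasDerivWithinAt h.phi.2).mono (Ici_subset_Ici.2 hT)
  have hχc : ContinuousOn χ (Ici T) :=
    (continuousOn_of_hasDerivWithinAt h.psi.2).mono (Ici_subset_Ici.2 hT)
  refine ⟨T, hT, q, fun t => φ t * (φ T)⁻¹, fun t => (χ T)⁻¹ * χ t, h.regular.mono hT,
    ⟨mul_inv_cancel₀ hφT, fun t ht => ?_⟩, ⟨inv_mul_cancel₀ hχT, fun t ht => ?_⟩, fun t ht =>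
    ⟨φ T * ν * χ T - φ T * μ t * χ T, ?_, ?_⟩⟩
  · exact (hasDerivWithinAt_Ici_mono ((h.phi.2 t (hT.trans ht)).mul_const _) hT).congr_deriv
      (mul_assoc _ _ _)
  · exact (hasDerivWithinAt_Ici_mono ((h.psi.2 t (hT.trans ht)).const_mul _) hT).congr_deriv
      (mul_assoc _ _ _).symm
  · refine hasImproperIntegral_of_tendsto (F := fun t => φ T * μ t * χ T) (fun s hs => ?_) ?_
      ((h.limit.const_mul _).mul_const _) ht
    · refine (hasDerivWithinAt_Ici_mono
        (((h.primitive s (hT.trans hs)).const_mul _).mul_const _) hT).congr_deriv ?_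
      simp only [mul_inv_rev, inv_inv, mul_assoc]
    · simp only [mul_inv_rev, inv_inv]
      exact ((continuousOn_const.mul (hφc.inv₀ fun t ht => h.phi_ne t (hT.trans ht))).mul
        (ha12.mono (Ici_subset_Ici.2 hT))).mul
        ((hχc.inv₀ fun t ht => h.psi_ne t (hT.trans ht)).mul continuousOn_const)
  · rw [← sub_mul, ← mul_sub]
    exact mul_ne_zero (mul_ne_zero hφT (sub_ne_zero.2 (hne t ht).symm)) hχT

/-- A primitive of `φ_q⁻¹ a ψ_q⁻¹` for an arbitrary regular solution in terms of the reference
solution. -/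
lemma IsReference.hasDerivWithinAt_transfer_inv (h : IsReference t₀ a11 a12 a21 a22 q φ χ μ ν)
    (hT : t₀ ≤ T) (ha11 : ContinuousOn a11 (Ici t₀)) (ha12 : ContinuousOn a12 (Ici t₀))
    (hr : IsRegularSol a12 (-a22) a11 (-a21) T r) (hf : IsPhi a12 a11 r T f)
    (hp : IsPsi a12 (-a22) r T p) :
    (∀ t ∈ Ici T, HasDerivWithinAt
      (fun t => (transfer q φ χ μ T (r T) (μ t))⁻¹ * ((μ t - μ T) * χ T))
      ((f t)⁻¹ * a12 t * (p t)⁻¹) (Ici T) t) ∧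
    ContinuousOn (fun t => (f t)⁻¹ * a12 t * (p t)⁻¹) (Ici T) := by
  set δ := χ T * (r T - q T) with hδ
  set u : ℝ → Quaternion ℝ := fun t => transfer q φ χ μ T (r T) (μ t) with hu
  have hu0 : ∀ t ≥ T, u t ≠ 0 := (h.exists_regular_iff hT ha11 ha12).1 ⟨r, hr, rfl⟩
  have hfu : ∀ t ≥ T, f t = φ t * u t := fun t ht => (h.phi_eq_transfer hT hr hf ht).1
  have hf0 : ∀ t ≥ T, f t ≠ 0 := fun t ht => by
    rw [hfu t ht]
    exact mul_ne_zero (h.phi_ne t (hT.trans ht)) (hu0 t ht)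
  have hy : ∀ t ≥ T, (χ t)⁻¹ * δ * (f t)⁻¹ = r t - q t := fun t ht => by
    have h1 := (h.phi_eq_transfer hT hr hf ht).2
    rw [← hδ] at h1
    rw [eq_sub_of_add_eq' h1.symm, ← sub_mul, mul_inv_cancel_right₀ (hf0 t ht)]
  set F : ℝ → Quaternion ℝ := fun t => (u t)⁻¹ * ((μ t - μ T) * χ T) with hF
  have hμ : ∀ t ∈ Ici T, HasDerivWithinAt μ ((φ t)⁻¹ * a12 t * (χ t)⁻¹) (Ici T) t :=
    fun t ht => hasDerivWithinAt_Ici_mono (h.primitive t (hT.trans ht)) hT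
  have hFd : ∀ t ∈ Ici T, HasDerivWithinAt F
      ((f t)⁻¹ * a12 t * ((χ t)⁻¹ * (χ T - δ * F t))) (Ici T) t := by
    intro t ht
    have h1 := (hasDerivWithinAt_inv_quaternion
      ((((hμ t ht).sub_const (μ T)).mul_const δ).const_add ((φ T)⁻¹)) (hu0 t ht)).mul
      (((hμ t ht).sub_const (μ T)).mul_const (χ T))
    refine h1.congr_deriv ?_
    change -((u t)⁻¹ * ((φ t)⁻¹ * a12 t * (χ t)⁻¹ * δ) * (u t)⁻¹) * ((μ t - μ T) * χ T) +
      (u t)⁻¹ * ((φ t)⁻¹ * a12 t * (χ t)⁻¹ * χ T) = _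
    rw [hfu t ht, mul_inv_rev, hF]
    noncomm_ring
  -- This product is constant, which identifies `p⁻¹` with the last factor in the derivative of `F`.
  have hP : ∀ t ≥ T, p t * ((χ t)⁻¹ * (χ T - δ * F t)) = 1 := by
    intro t ht
    have hχi : ∀ t ∈ Ici T, HasDerivWithinAt (fun t => (χ t)⁻¹)
        (-((-a22 t + q t * a12 t) * (χ t)⁻¹)) (Ici T) t := fun t ht =>
      hasDerivWithinAt_Ici_mono (h.hasDerivWithinAt_inv_psi (hT.trans ht)) hT
    rw [eq_of_hasDerivWithinAt_zero (f := fun t => p t * ((χ t)⁻¹ * (χ T - δ * F t)))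
      (fun s hs => ?_) ht, hp.1]
    · simp [hF, inv_mul_cancel₀ (h.psi_ne T hT)]
    · refine ((hp.2 s hs).mul ((hχi s hs).mul (((hFd s hs).const_mul δ).const_sub
        (χ T)))).congr_deriv ?_
      have h1 : (χ s)⁻¹ * (δ * ((f s)⁻¹ * a12 s * ((χ s)⁻¹ * (χ T - δ * F s)))) =
          (r s - q s) * (a12 s * ((χ s)⁻¹ * (χ T - δ * F s))) := by
        rw [← hy s hs]
        simp only [mul_assoc]
      simp only [Pi.neg_apply, mul_neg, h1, Pi.mul_apply]
      noncomm_ring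
  refine ⟨fun t ht => ?_, ?_⟩
  · rw [inv_eq_of_mul_eq_one_right (hP t ht)]
    exact hFd t ht
  · exact (((continuousOn_of_hasDerivWithinAt hf.2).inv₀ hf0).mul
      (ha12.mono (Ici_subset_Ici.2 hT))).mul ((continuousOn_of_hasDerivWithinAt hp.2).inv₀
      fun t ht => left_ne_zero_of_mul_eq_one (hP t ht))

/-- If `μ t = ν` for some `t ≥ T`, the explicit primitive attached to any `T`-regular solution has
the same value at `t` as at infinity, so the tail integral from `t` is zero. -/
lemma IsReference.eqExtremal_iff (h : IsReference t₀ a11 a12 a21 a22 q φ χ μ ν)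
    (ha11 : ContinuousOn a11 (Ici t₀)) (ha12 : ContinuousOn a12 (Ici t₀)) :
    EqExtremal t₀ a12 (-a22) a11 (-a21) ↔ ∃ T ≥ t₀, ∀ t ≥ T, μ t ≠ ν := by
  refine ⟨fun ⟨T, hT, r, f, p, hr, hf, hp, hν⟩ => ⟨T, hT, fun t ht hμ => ?_⟩,
    fun ⟨T, hT, hne⟩ => h.eqExtremal ha12 hT hne⟩
  obtain ⟨L, hL, hL0⟩ := hν t ht
  obtain ⟨hF, hG⟩ := h.hasDerivWithinAt_transfer_inv hT ha11 ha12 hr hf hp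
  have hu : transfer q φ χ μ T (r T) ν ≠ 0 := by
    rw [← hμ]
    exact (h.exists_regular_iff hT ha11 ha12).1 ⟨r, hr, rfl⟩ t ht
  have h1 := hasImproperIntegral_of_tendsto hF hG
    ((h.tendsto_transfer.inv₀ hu).mul ((h.limit.sub_const (μ T)).mul_const (χ T))) ht
  rw [hμ, sub_self] at h1
  exact hL0 (tendsto_nhds_unique hL h1)

lemma IsReference.eqNormal_iff (h : IsReference t₀ a11 a12 a21 a22 q φ χ μ ν)
    (ha11 : ContinuousOn a11 (Ici t₀)) (ha12 : ContinuousOn a12 (Ici t₀)) :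
    EqNormal t₀ a12 (-a22) a11 (-a21) ↔ ¬ ∃ T ≥ t₀, ∀ t ≥ T, μ t ≠ ν := by
  have hreg : EqRegular t₀ a12 (-a22) a11 (-a21) := ⟨t₀, le_rfl, q, h.regular⟩
  rw [EqNormal, and_iff_right hreg, not_iff_not]
  constructor
  · rintro ⟨T, hT, r, hr⟩
    exact ⟨T, hT, h.ne_of_isExtremalSol hT ha11 ha12 hr⟩
  · rintro ⟨T, hT, hne⟩
    exact ⟨T, hT, _, (h.isPrincipalAt hT ha11 ha12 (fun t _ => ⟨rfl, rfl⟩) one_ne_zero hne).2⟩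

lemma IsReference.sysRegular (h : IsReference t₀ a11 a12 a21 a22 q φ χ μ ν) :
    SysRegular t₀ a11 a12 a21 a22 :=
  ⟨t₀, le_rfl, φ, fun t => q t * φ t, h.phi.isSysSol h.regular, h.phi_ne⟩

lemma IsReference.tendsto_norm_div (h : IsReference t₀ a11 a12 a21 a22 q φ χ μ ν)
    (h₁ : HasCoefficients t₀ q φ χ μ f g α β) (h₂ : HasCoefficients t₀ q φ χ μ f₂ g₂ α₂ β₂)
    (h0 : α₂ + ν * β₂ ≠ 0) :
    Tendsto (fun t => ‖f t‖ / ‖f₂ t‖) atTop (𝓝 (‖α + ν * β‖ / ‖α₂ + ν * β₂‖)) := by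
  refine (((h.limit.mul_const β).const_add α).norm.div ((h.limit.mul_const β₂).const_add α₂).norm
    (norm_ne_zero_iff.2 h0)).congr' ?_
  filter_upwards [eventually_ge_atTop t₀] with t ht
  rw [(h₁ t ht).1, (h₂ t ht).1, norm_mul, norm_mul, Pi.div_apply,
    mul_div_mul_left _ _ (norm_ne_zero_iff.2 (h.phi_ne t ht))]

lemma exp_integral_eq {w : ℝ → ℝ} (hw : ContinuousOn w (Ici t₀)) (hT : t₀ ≤ T) {t : ℝ}
    (ht : T ≤ t) : Real.exp (∫ s in T..t, w s) =
      Real.exp (-∫ s in t₀..T, w s) * Real.exp (∫ s in t₀..t, w s) := by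
  have hi : ∀ {a b}, t₀ ≤ a → a ≤ b → IntervalIntegrable w volume a b := fun ha hab =>
    (hw.mono (by rw [uIcc_of_le hab]; exact fun x hx => ha.trans hx.1)).intervalIntegrable
  rw [← Real.exp_add, ← intervalIntegral.integral_add_adjacent_intervals (hi le_rfl hT) (hi hT ht)]
  simp

lemma continuousOn_weight (ha11 : ContinuousOn a11 (Ici t₀)) (ha12 : ContinuousOn a12 (Ici t₀))
    (ha22 : ContinuousOn a22 (Ici t₀)) (hT : t₀ ≤ T) (hf : ContinuousOn f (Ici T))
    (h0 : ∀ t ≥ T, f t ≠ 0) :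
    ContinuousOn (fun τ => ‖a12 τ‖ / ‖f τ‖ ^ 2 *
      Real.exp (∫ s in T..τ, ((a11 s).re + (a22 s).re))) (Ici T) := by
  have hw : ContinuousOn (fun s => (a11 s).re + (a22 s).re) (Ici T) :=
    ((continuousOn_re ha11).add (continuousOn_re ha22)).mono (Ici_subset_Ici.2 hT)
  refine ContinuousOn.mul (((ha12.mono (Ici_subset_Ici.2 hT)).norm).div (hf.norm.pow 2)
    fun t ht => pow_ne_zero 2 (norm_ne_zero_iff.2 (h0 t ht))) ?_
  exact Real.continuous_exp.comp_continuousOn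
    (continuousOn_of_hasDerivWithinAt fun t ht => hasDerivWithinAt_integral_Ici hw ht)

/-- Here `‖α + μ β‖ ≥ ε > 0` on the half-line, hence `‖f‖ ≥ ε exp ∫ Re a11`, and the integrand is
dominated by a multiple of that of `hβ`. -/
lemma IsReference.integrableOn_weight (h : IsReference t₀ a11 a12 a21 a22 q φ χ μ ν)
    (ha11 : ContinuousOn a11 (Ici t₀)) (ha12 : ContinuousOn a12 (Ici t₀))
    (ha22 : ContinuousOn a22 (Ici t₀))
    (hβ : IntegrableOn
      (fun τ => ‖a12 τ‖ * Real.exp (∫ s in t₀..τ, ((a22 s).re - (a11 s).re))) (Ioi t₀))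
    (hT : t₀ ≤ T) (hc : HasCoefficients t₀ q φ χ μ f g α β) (hν : α + ν * β ≠ 0)
    (h0 : ∀ t ≥ T, f t ≠ 0) :
    IntegrableOn (fun τ => ‖a12 τ‖ / ‖f τ‖ ^ 2 *
        Real.exp (∫ s in T..τ, ((a11 s).re + (a22 s).re))) (Ioi T) := by
  have r11 := continuousOn_re ha11
  have r22 := continuousOn_re ha22
  have hfc : ContinuousOn f (Ici T) := continuousOn_of_hasDerivWithinAt fun t ht =>
    ((h.isSysSol hc).mono hT t ht).1
  obtain ⟨ε, hε, hge⟩ := exists_norm_ge_of_tendsto_ne_zero (T := T) (f := fun t => α + μ t * β)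
    (continuousOn_const.add ((h.continuousOn_primitive hT).mul continuousOn_const))
    ((h.limit.mul_const β).const_add α) hν (fun t ht => right_ne_zero_of_mul
      ((hc t (hT.trans ht)).1 ▸ h0 t ht))
  have hβT := (hβ.mono_set (Ioi_subset_Ioi hT)).const_mul
    (Real.exp (-∫ s in t₀..T, ((a11 s).re + (a22 s).re)) * (ε ^ 2)⁻¹)
  refine hβT.mono' (((continuousOn_weight ha11 ha12 ha22 hT hfc h0).mono
    Ioi_subset_Ici_self).aestronglyMeasurable measurableSet_Ioi) ?_
  refine (ae_restrict_iff' measurableSet_Ioi).2 (ae_of_all _ fun t ht => ?_)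
  have ht1 : T ≤ t := le_of_lt ht
  have ht0 : t₀ ≤ t := hT.trans ht1
  have hint : ∀ {f : ℝ → ℝ}, ContinuousOn f (Ici t₀) → IntervalIntegrable f volume t₀ t :=
    fun hf => (hf.mono (by rw [uIcc_of_le ht0]; exact Icc_subset_Ici_self)).intervalIntegrable
  have e1 : Real.exp (∫ s in t₀..t, ((a22 s).re - (a11 s).re)) =
      Real.exp (∫ s in t₀..t, ((a11 s).re + (a22 s).re)) *
        (Real.exp (∫ s in t₀..t, (a11 s).re) ^ 2)⁻¹ := by
    rw [← Real.exp_nat_mul, ← Real.exp_neg, ← Real.exp_add,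
      intervalIntegral.integral_add (hint r11) (hint r22),
      intervalIntegral.integral_sub (hint r22) (hint r11)]
    push_cast
    ring_nf
  have e2 : (‖f t‖ ^ 2)⁻¹ ≤ (Real.exp (∫ s in t₀..t, (a11 s).re) ^ 2)⁻¹ * (ε ^ 2)⁻¹ := by
    rw [← mul_inv, ← mul_pow, (hc t ht0).1, norm_mul]
    gcongr
    · exact h.exp_le t ht0
    · exact hge t ht1
  rw [Real.norm_of_nonneg (by positivity), e1, div_eq_mul_inv,
    exp_integral_eq (w := fun s => (a11 s).re + (a22 s).re) (r11.add r22) hT ht1]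
  calc _ ≤ ‖a12 t‖ * ((Real.exp (∫ s in t₀..t, (a11 s).re) ^ 2)⁻¹ * (ε ^ 2)⁻¹) *
        (Real.exp (-∫ s in t₀..T, ((a11 s).re + (a22 s).re)) *
          Real.exp (∫ s in t₀..t, ((a11 s).re + (a22 s).re))) := by gcongr
    _ = _ := by ring

/-- Up to a constant the integral is the length of the curve `R = (μ - ν)⁻¹`, which is at least `‖R
t‖ - ‖R T‖` and so tends to infinity. -/
lemma IsReference.tendsto_integral_weight (h : IsReference t₀ a11 a12 a21 a22 q φ χ μ ν)
    (ha11 : ContinuousOn a11 (Ici t₀)) (ha12 : ContinuousOn a12 (Ici t₀))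
    (ha22 : ContinuousOn a22 (Ici t₀)) (hT : t₀ ≤ T)
    (hc : HasCoefficients t₀ q φ χ μ f g (-(ν * β)) β) (hβ : β ≠ 0) (h0 : ∀ t ≥ T, f t ≠ 0) :
    Tendsto (fun t => ∫ τ in T..t, ‖a12 τ‖ / ‖f τ‖ ^ 2 *
      Real.exp (∫ s in T..τ, ((a11 s).re + (a22 s).re))) atTop atTop := by
  have hfc : ContinuousOn f (Ici T) := continuousOn_of_hasDerivWithinAt fun t ht =>
    ((h.isSysSol hc).mono hT t ht).1
  have hfμ : ∀ t ≥ T, f t = φ t * ((μ t - ν) * β) := fun t ht => by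
    rw [(hc t (hT.trans ht)).1]
    noncomm_ring
  have hμ0 : ∀ t ≥ T, μ t - ν ≠ 0 := fun t ht =>
    left_ne_zero_of_mul (right_ne_zero_of_mul (hfμ t ht ▸ h0 t ht))
  set R : ℝ → Quaternion ℝ := fun t => (μ t - ν)⁻¹ with hR
  set R' : ℝ → Quaternion ℝ := fun t =>
    -((μ t - ν)⁻¹ * ((φ t)⁻¹ * a12 t * (χ t)⁻¹) * (μ t - ν)⁻¹) with hR'
  have hRd : ∀ t ∈ Ici T, HasDerivWithinAt R (R' t) (Ici T) t := fun t ht =>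
    hasDerivWithinAt_inv_quaternion
      (hasDerivWithinAt_Ici_mono ((h.primitive t (hT.trans ht)).sub_const ν) hT) (hμ0 t ht)
  have hφc : ContinuousOn φ (Ici T) :=
    (continuousOn_of_hasDerivWithinAt h.phi.2).mono (Ici_subset_Ici.2 hT)
  have hχc : ContinuousOn χ (Ici T) :=
    (continuousOn_of_hasDerivWithinAt h.psi.2).mono (Ici_subset_Ici.2 hT)
  have hRc : ContinuousOn R (Ici T) := continuousOn_of_hasDerivWithinAt hRd
  have hR'c : ContinuousOn R' (Ici T) := ((hRc.mul
    (((hφc.inv₀ fun t ht => h.phi_ne t (hT.trans ht)).mul (ha12.mono (Ici_subset_Ici.2 hT))).mul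
      (hχc.inv₀ fun t ht => h.psi_ne t (hT.trans ht)))).mul hRc).neg
  set C := Real.exp (-∫ s in t₀..T, ((a11 s).re + (a22 s).re)) * (‖β‖ ^ 2)⁻¹ with hC
  have hCpos : 0 < C := by
    have := norm_pos_iff.2 hβ
    positivity
  have hw : ∀ t ≥ T, ‖a12 t‖ / ‖f t‖ ^ 2 *
      Real.exp (∫ s in T..t, ((a11 s).re + (a22 s).re)) = C * ‖R' t‖ := by
    intro t ht
    have hχ := norm_pos_iff.2 (h.psi_ne t (hT.trans ht))
    have hφ := norm_pos_iff.2 (h.phi_ne t (hT.trans ht))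
    have hμ := norm_pos_iff.2 (hμ0 t ht)
    have hβ' := norm_pos_iff.2 hβ
    have e1 : Real.exp (∫ s in t₀..t, ((a11 s).re + (a22 s).re)) = ‖φ t‖ / ‖χ t‖ := by
      rw [← h.norm_psi t (hT.trans ht)]
      field_simp
    rw [exp_integral_eq (w := fun s => (a11 s).re + (a22 s).re)
      ((continuousOn_re ha11).add (continuousOn_re ha22)) hT ht, e1, hfμ t ht,
      hC, hR']
    simp only [norm_neg, norm_mul, norm_inv]
    field_simp
  have hRlim : Tendsto (fun t => ‖R t‖) atTop atTop := by
    have h1 : Tendsto (fun t => ‖μ t - ν‖) atTop (𝓝[>] 0) := by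
      refine tendsto_nhdsWithin_iff.2 ⟨?_, ?_⟩
      · simpa using (h.limit.sub_const ν).norm
      · filter_upwards [eventually_ge_atTop T] with t ht
        exact norm_pos_iff.2 (hμ0 t ht)
    simpa [hR, norm_inv, Function.comp_def] using tendsto_inv_nhdsGT_zero.comp h1
  refine tendsto_atTop_mono' _ ?_
    ((tendsto_atTop_add_const_right _ (-‖R T‖) hRlim).const_mul_atTop hCpos)
  filter_upwards [eventually_ge_atTop T] with t ht
  have e2 : ∫ τ in T..t, ‖a12 τ‖ / ‖f τ‖ ^ 2 *
      Real.exp (∫ s in T..τ, ((a11 s).re + (a22 s).re)) = C * ∫ τ in T..t, ‖R' τ‖ := by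
    rw [← intervalIntegral.integral_const_mul]
    refine intervalIntegral.integral_congr fun τ hτ => ?_
    rw [uIcc_of_le ht] at hτ
    exact hw τ hτ.1
  rw [e2]
  gcongr
  have e3 := intervalIntegral.norm_integral_le_integral_norm (f := R') (μ := volume) ht
  rw [integral_eq_sub_of_hasDerivWithinAt_Ici hRd hR'c ht] at e3
  linarith [norm_sub_norm_le (R t) (R T)]

end Extremal

end QuatRiccati

end

/-! ### Assembly from the coefficient description. -/

theorem theorem4p2 (t₀ : ℝ) (a11 a12 a21 a22 : ℝ → Quaternion ℝ)
    (ha11 : ContinuousOn a11 (Ici t₀)) (ha12 : ContinuousOn a12 (Ici t₀))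
    (ha21 : ContinuousOn a21 (Ici t₀)) (ha22 : ContinuousOn a22 (Ici t₀))
    (S : Finset (Fin 4)) (hS : S.Nonempty)
    (hα_nonneg : ∀ n ∈ S, ∀ t ≥ t₀, 0 ≤ QuatRiccati.comp (a12 t) n)
    (hα_zero : ∀ n ∈ S, ∀ t ≥ t₀, QuatRiccati.comp (a12 t) n = 0 →
      ∀ m, QuatRiccati.pCoef (-a22 t) (a11 t) n m = 0)
    (hα_compl : ∀ n ∉ S, ∀ t ≥ t₀, QuatRiccati.comp (a12 t) n = 0)
    (hα_disc : ∀ n, ∀ t ≥ t₀, QuatRiccati.disc (a12 t) (-a22 t) (a11 t) (-a21 t) n ≤ 0)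
    (hβ : IntegrableOn
      (fun τ => ‖a12 τ‖ * Real.exp (∫ s in t₀..τ, ((a22 s).re - (a11 s).re))) (Ioi t₀)) :
    -- 1) exactly one of the two alternatives
    Xor (QuatRiccati.SysNormal t₀ a11 a12 a21 a22)
      (QuatRiccati.SysExtremal t₀ a11 a12 a21 a22) ∧
    -- 2) convergence for the non-principal solutions
    (∀ T ≥ t₀, ∀ φ ψ : ℝ → Quaternion ℝ,
      QuatRiccati.IsNonPrincipalAt t₀ a11 a12 a21 a22 T φ ψ →
      IntegrableOn (fun τ => ‖a12 τ‖ / ‖φ τ‖ ^ 2 *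
        Real.exp (∫ s in T..τ, ((a11 s).re + (a22 s).re))) (Ioi T)) ∧
    -- 3) the extremal case
    (QuatRiccati.SysExtremal t₀ a11 a12 a21 a22 →
      -- existence and uniqueness of the principal solution up to a right multiplier
      (∃ φs ψs : ℝ → Quaternion ℝ, QuatRiccati.IsPrincipal t₀ a11 a12 a21 a22 φs ψs ∧
        ∀ φ ψ : ℝ → Quaternion ℝ, QuatRiccati.IsPrincipal t₀ a11 a12 a21 a22 φ ψ ↔
          QuatRiccati.RightDependent t₀ φs ψs φ ψ) ∧
      -- divergence for the principal solution
      (∀ φs ψs : ℝ → Quaternion ℝ, QuatRiccati.IsPrincipal t₀ a11 a12 a21 a22 φs ψs →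
        ∀ T ≥ t₀, (∀ t ≥ T, φs t ≠ 0) →
          Tendsto (fun t => ∫ τ in T..t, ‖a12 τ‖ / ‖φs τ‖ ^ 2 *
            Real.exp (∫ s in T..τ, ((a11 s).re + (a22 s).re))) atTop atTop) ∧
      -- the principal solution is small compared with each non-principal one
      (∀ φs ψs φ ψ : ℝ → Quaternion ℝ, QuatRiccati.IsPrincipal t₀ a11 a12 a21 a22 φs ψs →
        QuatRiccati.IsNonPrincipal t₀ a11 a12 a21 a22 φ ψ →
          Tendsto (fun t => ‖φs t‖ / ‖φ t‖) atTop (𝓝 0)) ∧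
      -- two non-principal solutions are comparable
      (∀ φ₁ ψ₁ φ₂ ψ₂ : ℝ → Quaternion ℝ,
        QuatRiccati.IsNonPrincipal t₀ a11 a12 a21 a22 φ₁ ψ₁ →
        QuatRiccati.IsNonPrincipal t₀ a11 a12 a21 a22 φ₂ ψ₂ →
          ∃ c : ℝ, c ≠ 0 ∧ Tendsto (fun t => ‖φ₁ t‖ / ‖φ₂ t‖) atTop (𝓝 c))) := by
  obtain ⟨q, φ, χ, μ, ν, h⟩ := QuatRiccati.exists_isReference ha11 ha12 ha21 ha22 S hα_nonneg
    hα_zero hα_compl hα_disc hβ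
  have hE := h.eqExtremal_iff ha11 ha12
  have hN := h.eqNormal_iff ha11 ha12
  refine ⟨?_, fun T hT f g hp => ?_, fun hext => ⟨?_, fun f g hp T hT h0 => ?_,
    fun f g f₂ g₂ hp hp₂ => ?_, fun f g f₂ g₂ hp hp₂ => ?_⟩⟩
  · rw [QuatRiccati.SysNormal, QuatRiccati.SysExtremal, and_iff_right h.sysRegular,
      and_iff_right h.sysRegular, hN, hE]
    exact xor_not_left.2 Iff.rfl
  · obtain ⟨α, β, hc, hν⟩ := h.hasCoefficients_of_isNonPrincipalAt hT ha11 ha12 hp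
    exact h.integrableOn_weight ha11 ha12 ha22 hβ hT hc hν hp.1.2
  · obtain ⟨T, hT, hne⟩ := hE.1 hext.2
    have hP : ∀ {f g : ℝ → Quaternion ℝ} {β : Quaternion ℝ}, β ≠ 0 →
        QuatRiccati.HasCoefficients t₀ q φ χ μ f g (-(ν * β)) β →
        QuatRiccati.IsPrincipal t₀ a11 a12 a21 a22 f g := fun hβ hc =>
      ⟨T, hT, h.isPrincipalAt hT ha11 ha12 hc hβ hne⟩
    -- The principal solution is the one with coefficients `(-ν, 1)`; any other has coefficients
    -- `(-ν β, β)`, hence is its right multiple by `β`.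
    refine ⟨_, _, hP one_ne_zero fun t _ => ⟨rfl, rfl⟩, fun f g => ⟨fun hp => ?_, ?_⟩⟩
    · obtain ⟨β, hβ, hc⟩ := h.hasCoefficients_of_isPrincipal ha11 ha12 hp
      refine ⟨β, hβ, fun t ht => ⟨?_, ?_⟩⟩
      · rw [(hc t ht).1]
        noncomm_ring
      · rw [(hc t ht).2, (hc t ht).1]
        noncomm_ring
    · rintro ⟨l, hl, hfg⟩
      refine hP hl fun t ht => ⟨?_, ?_⟩
      · rw [(hfg t ht).1]
        noncomm_ring
      · rw [(hfg t ht).2, (hfg t ht).1]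
        noncomm_ring
  -- The coefficients are taken on all of `[t₀, +∞)`, so `T` need not be the point at which the
  -- solution was found to be principal.
  · obtain ⟨β, hβ, hc⟩ := h.hasCoefficients_of_isPrincipal ha11 ha12 hp
    exact h.tendsto_integral_weight ha11 ha12 ha22 hT hc hβ h0
  · obtain ⟨β, hβ, hc⟩ := h.hasCoefficients_of_isPrincipal ha11 ha12 hp
    obtain ⟨T, hT, hp₂⟩ := hp₂
    obtain ⟨α₂, β₂, hc₂, hν₂⟩ := h.hasCoefficients_of_isNonPrincipalAt hT ha11 ha12 hp₂
    simpa using h.tendsto_norm_div hc hc₂ hν₂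
  · obtain ⟨T, hT, hp⟩ := hp
    obtain ⟨T₂, hT₂, hp₂⟩ := hp₂
    obtain ⟨α, β, hc, hν⟩ := h.hasCoefficients_of_isNonPrincipalAt hT ha11 ha12 hp
    obtain ⟨α₂, β₂, hc₂, hν₂⟩ := h.hasCoefficients_of_isNonPrincipalAt hT₂ ha11 ha12 hp₂
    exact ⟨_, div_ne_zero (norm_ne_zero_iff.2 hν) (norm_ne_zero_iff.2 hν₂),
      h.tendsto_norm_div hc hc₂ hν₂⟩
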